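/- Setting. Let $\mathcal S$ and $\mathcal A$ be finite sets and $\bar{\mathcal S}=\mathcal S\cup\{e\}$ with $e\notin\mathcal S$. Consider a Markov decision process with states $\bar{\mathcal S}$, actions $\mathcal A$, transition probabilities $p(s,a,s')$, real rewards $r(s,a,s')$ of arbitrary sign, and initial distribution $\mu$ on $\bar{\mathcal S}$, such that $e$ is a sink, i.e. $p(e,a,e)=1$ and $r(e,a,e)=0$ for all $a$, and such that $\mu(e)=0$ and $\mu(s)>0$ for all $s\in\mathcal S$. Assume that the process is transient: $\sum_{t\ge 0}\mathbb P^{\pi,s}[\tilde s_t=s']<\infty$ for all $s,s'\in\mathcal S$ and every stationary deterministic policy $\pi$. Let $\Pi_{\mathrm{HR}}$ be the set of history-dependent randomized policies and $\Pi_{\mathrm{SD}}$ the set of stationary deterministic ones. Let $\mathrm{ERM}_\beta[X]=-\beta^{-1}\log\mathbb E[e^{-\beta X}]$ for $\beta>0$, $\mathrm{ERM}_0[X]=\mathbb E[X]$, and, for a fixed $\alpha\in(0,1)$, $\mathrm{EVaR}_\alpha[X]=\sup_{\beta>0}\big(\mathrm{ERM}_\beta[X]+\beta^{-1}\log\alpha\big)$.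 Put $$X_t=\sum_{k=0}^{t}r(\tilde s_k,\tilde a_k,\tilde s_{k+1}),\qquad g_t(\pi,\beta)=\mathrm{ERM}^{\pi,\mu}_\beta[X_t],\qquad g_t^\star(\beta)=\sup_{\pi\in\Pi_{\mathrm{HR}}}g_t(\pi,\beta),$$ $$g_\infty(\pi,\beta)=\liminf_{t\to\infty}g_t(\pi,\beta),\qquad g^\star_\infty(\beta)=\liminf_{t\to\infty}g^\star_t(\beta),\qquad h_\infty(\pi,\beta)=g_\infty(\pi,\beta)+\beta^{-1}\log\alpha ,$$ with values in the extended reals. For $\delta>0$ and $\beta_0>0$ let $\mathcal B(\beta_0,\delta)=\{\beta_0,\beta_1,\dots,\beta_K\}$ be the finite grid obtained from $\beta_0$ by iterating $$\beta_{k+1}=\frac{\beta_k\log\alpha}{\beta_k\delta+\log\alpha}$$ as long as $\beta_k<-\log(\alpha)/\delta$, where the first iterate that is $\ge-\log(\alpha)/\delta$ is replaced by $\beta_K=-\log(\alpha)/\delta$ (if $\beta_0\ge-\log(\alpha)/\delta$, then $\mathcal B(\beta_0,\delta)=\{\beta_0\}$). Theorem. Let $\delta>0$. There exists $\beta_0>0$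 with $$g^\star_\infty(0)\le g^\star_\infty(\beta_0)+\delta. \tag{1}$$ For every $\pi\in\Pi_{\mathrm{HR}}$ the limit $\lim_{t\to\infty}\mathrm{EVaR}^{\pi,\mu}_\alpha[X_t]$ exists in $\mathbb R$. For every $\beta_0>0$ that satisfies (1) and every $$(\pi^\star,\beta^\star)\in\operatorname*{arg\,max}_{(\pi,\beta)\in\Pi_{\mathrm{SD}}\times\mathcal B(\beta_0,\delta)}h_\infty(\pi,\beta)$$ one has $$\lim_{t\to\infty}\mathrm{EVaR}^{\pi^\star,\mu}_\alpha[X_t]\;\ge\;\sup_{\pi\in\Pi_{\mathrm{HR}}}\liminf_{t\to\infty}\mathrm{EVaR}^{\pi,\mu}_\alpha[X_t]\;-\;\delta .$$ -/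

import Mathlib

open Filter Topology

noncomputable section

/-- A history `s₀, a₀, s₁, …, a_{n-1}, s_n`: the `n + 1` visited states and the `n` actions taken.
States are elements of `Option S`: the non-sink states are `some s`, and `none` is the sink `e`. -/
abbrev Hist (S A : Type*) (n : ℕ) : Type _ := (Fin (n + 1) → Option S) × (Fin n → A)

/-- The part of a history that is known when the `k`-th action is chosen:
the states `s₀, …, s_k` and the actions `a₀, …, a_{k-1}`. -/
def Hist.upTo {S A : Type*} {n : ℕ} (ω : Hist S A n) (k : Fin n) : Hist S A (k : ℕ) :=
  (fun i => ω.1 (Fin.castLE (by omega) i), fun i => ω.2 (Fin.castLE (by omega) i))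

/-- A finite Markov decision process with states `Option S` (sink `none`) and actions `A`. -/
structure FinMDP (S A : Type*) [Fintype S] [Fintype A] where
  /-- transition probabilities `p(s, a, s')` -/
  p : Option S → A → Option S → ℝ
  p_mem : ∀ s a, p s a ∈ stdSimplex ℝ (Option S)
  /-- rewards `r(s, a, s')` -/
  r : Option S → A → Option S → ℝ
  /-- initial distribution -/
  init : Option S → ℝ
  init_mem : init ∈ stdSimplex ℝ (Option S)
  p_sink : ∀ a, p none a none = 1
  r_sink : ∀ a, r none a none = 0
  init_sink : init none = 0

/-- A history-dependent randomized policy: for each time and each history up to that time,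
a probability distribution over actions. -/
structure HistPolicy (S A : Type*) [Fintype S] [Fintype A] where
  prob : (t : ℕ) → Hist S A t → A → ℝ
  prob_mem : ∀ t h, prob t h ∈ stdSimplex ℝ A

open Classical in
/-- The stationary deterministic policy of a decision rule `d`, as a history-dependent policy: in
every period it plays `d s` with probability one, where `s` is the current state.
(The action `d none` in the sink affects neither transitions nor rewards.) -/
def HistPolicy.stationary {S A : Type*} [Fintype S] [Fintype A] (d : Option S → A) :
    HistPolicy S A where
  prob t h := Pi.single (d (h.1 (Fin.last t))) 1
  prob_mem _ _ := single_mem_stdSimplex ℝ _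

/-! ### Entropic risk measure of a random variable on a finite probability space -/

/-- `ERM_β[X]` for a random variable `X` on a finite space `Ω` with probability weights `P`:
`-β⁻¹ log E[exp(-β X)]` for `β > 0`, and `E[X]` for `β = 0`. -/
def erm {Ω : Type*} [Fintype Ω] (P : Ω → ℝ) (β : ℝ) (X : Ω → ℝ) : ℝ :=
  if β = 0 then ∑ ω, P ω * X ω
  else -β⁻¹ * Real.log (∑ ω, P ω * Real.exp (-β * X ω))

/-- `EVaR_α[X] = sup_{β > 0} (ERM_β[X] + β⁻¹ log α)`. -/
def evar {Ω : Type*} [Fintype Ω] (P : Ω → ℝ) (α : ℝ) (X : Ω → ℝ) : EReal :=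
  ⨆ β : {β : ℝ // 0 < β}, ((erm P β X + (β : ℝ)⁻¹ * Real.log α : ℝ) : EReal)

namespace FinMDP

variable {S A : Type*} [Fintype S] [Fintype A]

/-- The probability of the history `ω` of length `n` when the initial state has distribution `ν`
and the actions are governed by the policy `π`. -/
def pathProb (M : FinMDP S A) (ν : Option S → ℝ) (π : HistPolicy S A) {n : ℕ}
    (ω : Hist S A n) : ℝ :=
  ν (ω.1 0) * ∏ k : Fin n,
    (π.prob k (ω.upTo k) (ω.2 k) * M.p (ω.1 k.castSucc) (ω.2 k) (ω.1 k.succ))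

/-- The total reward `∑_{k<n} r(s_k, a_k, s_{k+1})` collected along a history. -/
def totalReward (M : FinMDP S A) {n : ℕ} (ω : Hist S A n) : ℝ :=
  ∑ k : Fin n, M.r (ω.1 k.castSucc) (ω.2 k) (ω.1 k.succ)

open Classical in
/-- `P^{π,s}[s_t = s']`: the process starts in the state `s`. -/
def stateProb (M : FinMDP S A) (π : HistPolicy S A) (s : Option S) (t : ℕ) (s' : Option S) : ℝ :=
  ∑ ω : Hist S A t, if ω.1 (Fin.last t) = s' then M.pathProb (Pi.single s 1) π ω else 0

/-- Under every stationary deterministic policy, the expected number of visits to each non-sink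
state from each non-sink state is finite. -/
def IsTransient (M : FinMDP S A) : Prop :=
  ∀ d : Option S → A, ∀ s s' : S,
    Summable fun t => M.stateProb (HistPolicy.stationary d) (some s) t (some s')

/-- `g_t(π, β)`: the ERM of `∑_{k=0}^{t} r(s_k, a_k, s_{k+1})`, a sum of `t + 1` rewards. -/
def g (M : FinMDP S A) (t : ℕ) (π : HistPolicy S A) (β : ℝ) : ℝ :=
  erm (fun ω : Hist S A (t + 1) => M.pathProb M.init π ω) β M.totalReward

/-- `g_t^⋆(β)`, the supremum over all history-dependent policies. -/
def gStar (M : FinMDP S A) (t : ℕ) (β : ℝ) : EReal :=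
  ⨆ π : HistPolicy S A, (M.g t π β : EReal)

/-- `g_∞(π, β) = liminf_t g_t(π, β)`. -/
def gInf (M : FinMDP S A) (π : HistPolicy S A) (β : ℝ) : EReal :=
  liminf (fun t => (M.g t π β : EReal)) atTop

/-- `g_∞^⋆(β) = liminf_t g_t^⋆(β)`. -/
def gStarInf (M : FinMDP S A) (β : ℝ) : EReal :=
  liminf (fun t => M.gStar t β) atTop

/-- `h_∞(π, β) = g_∞(π, β) + β⁻¹ log α`. -/
def hInf (M : FinMDP S A) (α : ℝ) (π : HistPolicy S A) (β : ℝ) : EReal :=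
  M.gInf π β + ((β⁻¹ * Real.log α : ℝ) : EReal)

/-- The EVaR of `∑_{k=0}^{t} r(s_k, a_k, s_{k+1})` under the policy `π`. -/
def evarReturn (M : FinMDP S A) (α : ℝ) (π : HistPolicy S A) (t : ℕ) : EReal :=
  evar (fun ω : Hist S A (t + 1) => M.pathProb M.init π ω) α M.totalReward

/-- The optimal EVaR total reward, `sup_π liminf_t EVaR_α^π[∑_{k=0}^{t} r(s_k, a_k, s_{k+1})]`,
over all history-dependent policies. -/
def optEvar (M : FinMDP S A) (α : ℝ) : EReal :=
  ⨆ π : HistPolicy S A, liminf (fun t => M.evarReturn α π t) atTop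

end FinMDP

/-- The discretization points: start from `β₀`, iterate
`β_{k+1} = β_k log α / (β_k δ + log α)`, and replace the first iterate that reaches
`-log α / δ` or more by `-log α / δ`, where the sequence stops (it is constant from there on).
The denominator is negative as long as `β_k < -log α / δ`. -/
def gridSeq (α β₀ δ : ℝ) : ℕ → ℝ
  | 0 => β₀
  | k + 1 =>
    if gridSeq α β₀ δ k < -Real.log α / δ then
      min (gridSeq α β₀ δ k * Real.log α / (gridSeq α β₀ δ k * δ + Real.log α))
        (-Real.log α / δ)
    else gridSeq α β₀ δ k

/-- The grid `B(β₀, δ) = {β₀, β₁, …, β_K}`. -/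
def betaGrid (α β₀ δ : ℝ) : Set ℝ := Set.range (gridSeq α β₀ δ)

theorem gridSeq_pos (α β₀ δ : ℝ) (h1 : 0 < α) (h2 : α < 1) (hβ : 0 < β₀) (hδ : 0 < δ) (k : ℕ) :
    0 < gridSeq α β₀ δ k := by
  have hl : Real.log α < 0 := Real.log_neg h1 h2
  induction k with
  | zero => exact hβ
  | succ k ih =>
    rw [gridSeq]
    split_ifs with h
    · have : gridSeq α β₀ δ k * δ + Real.log α < 0 := by
        rw [lt_div_iff₀ hδ] at h; linarith
      exact lt_min (div_pos_of_neg_of_neg (mul_neg_of_pos_of_neg ih hl) this)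
        (div_pos (by linarith) hδ)
    · exact ih

theorem betaGrid_finite {α β₀ δ : ℝ} (hα : α ∈ Set.Ioo (0 : ℝ) 1) (hβ : 0 < β₀) (hδ : 0 < δ) :
    (betaGrid α β₀ δ).Finite := by
  have hl : Real.log α < 0 := Real.log_neg hα.1 hα.2
  have key : ∃ k, ¬ gridSeq α β₀ δ k < -Real.log α / δ := by
    by_contra! hlt
    have step : ∀ k, (gridSeq α β₀ δ (k + 1))⁻¹ = (gridSeq α β₀ δ k)⁻¹ - δ / (-Real.log α) := by
      intro k
      have hp := gridSeq_pos α β₀ δ hα.1 hα.2 hβ hδ k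
      have h1 : gridSeq α β₀ δ (k + 1) = gridSeq α β₀ δ k * Real.log α /
          (gridSeq α β₀ δ k * δ + Real.log α) := by
        have h2 := hlt (k + 1)
        rw [gridSeq, if_pos (hlt k)] at h2 ⊢
        rcases min_choice (gridSeq α β₀ δ k * Real.log α /
          (gridSeq α β₀ δ k * δ + Real.log α)) (-Real.log α / δ) with h | h
        · exact h
        · rw [h] at h2; exact absurd h2 (lt_irrefl _)
      rw [h1, inv_div]
      have hne := hl.ne
      field_simp
      ring
    have all : ∀ k : ℕ, (gridSeq α β₀ δ k)⁻¹ = β₀⁻¹ - k * (δ / (-Real.log α)) := by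
      intro k
      induction k with
      | zero => simp [gridSeq]
      | succ k ih => rw [step, ih]; push_cast; ring
    obtain ⟨n, hn⟩ := exists_nat_gt (β₀⁻¹ / (δ / (-Real.log α)))
    have hc : 0 < δ / (-Real.log α) := div_pos hδ (by linarith)
    rw [div_lt_iff₀ hc] at hn
    have := inv_pos.2 (gridSeq_pos α β₀ δ hα.1 hα.2 hβ hδ n)
    rw [all] at this
    linarith
  obtain ⟨K, hK⟩ := key
  have hconst : ∀ j, gridSeq α β₀ δ (K + j) = gridSeq α β₀ δ K := by
    intro j
    induction j with
    | zero => rfl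
    | succ j ih => rw [← add_assoc, gridSeq, ih, if_neg hK]
  refine ((Finset.range (K + 1)).finite_toSet.image (gridSeq α β₀ δ)).subset ?_
  rintro _ ⟨k, rfl⟩
  rcases le_or_gt k K with h | h
  · exact ⟨k, by simpa using Nat.lt_succ_of_le h, rfl⟩
  · obtain ⟨j, rfl⟩ := Nat.exists_eq_add_of_le h.le
    exact ⟨K, by simp, (hconst j).symm⟩

end

/-! For `β > 0` the entropic risk is a decreasing function of the moment `E[exp(-β X)]`, which `phi`
computes by iterating the weighted transition operators `kern β a`. Inequalities between a function
and its images under all these operators pass to every policy, however randomized or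
history-dependent.

Transience is assumed only for stationary deterministic policies, but the limit of the maximal
survival probabilities is reproduced by one decision rule, so it vanishes
(`exists_liveMax_le_half`). Hence a fixed fraction of the surviving weight is absorbed every `N`
steps. The moment therefore converges or tends to infinity (`phi_one_tendsto`), and for small `|β|`
it is bounded uniformly in policy and horizon (`exists_phi_one_le`). The bound gives (1) through a
second-order estimate near `β = 0`.

Stationary policies suffice at each fixed `β > 0` (`exists_stationary_tendsto_le`): value iteration
on the absorbed weight alone increases, is bounded because `init` is positive off the sink, and its
limit yields a decision rule.

Since ERM decreases in `β` and the penalty `β⁻¹ log α` increases, finitely many grid points control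
all risk levels. This lets limit and supremum over `β` be exchanged (`tendsto_iSup_add_penalty`),
and it gives the final error `δ`: (1) covers `β < β₀`, and the grid spacing covers `β ≥ β₀`
(`hInf_le_of_grid`). -/

noncomputable section

namespace FinMDP

/-! ### Splitting off the last step of a history -/

section Snoc

variable {S A : Type*}

/-- A history of length `n + 1` is a history of length `n`, an action, and a state. -/
def histSnoc (S A : Type*) (n : ℕ) : Hist S A n × (A × Option S) ≃ Hist S A (n + 1) where
  toFun x := (Fin.snoc (α := fun _ => Option S) x.1.1 x.2.2, Fin.snoc (α := fun _ => A) x.1.2 x.2.1)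
  invFun ω := ((Fin.init ω.1, Fin.init ω.2), (ω.2 (Fin.last n), ω.1 (Fin.last (n + 1))))
  left_inv x := by simp
  right_inv ω := by simp

theorem histSnoc_fst_castSucc {n : ℕ} (x : Hist S A n × (A × Option S)) (k : Fin (n + 1)) :
    (histSnoc S A n x).1 k.castSucc = x.1.1 k := by
  simp [histSnoc]

theorem histSnoc_fst_last {n : ℕ} (x : Hist S A n × (A × Option S)) :
    (histSnoc S A n x).1 (Fin.last (n + 1)) = x.2.2 := by
  simp [histSnoc]

theorem histSnoc_snd_castSucc {n : ℕ} (x : Hist S A n × (A × Option S)) (k : Fin n) :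
    (histSnoc S A n x).2 k.castSucc = x.1.2 k := by
  simp [histSnoc]

theorem histSnoc_snd_last {n : ℕ} (x : Hist S A n × (A × Option S)) :
    (histSnoc S A n x).2 (Fin.last n) = x.2.1 := by
  simp [histSnoc]

theorem histSnoc_upTo_castSucc {n : ℕ} (x : Hist S A n × (A × Option S)) (k : Fin n) :
    (histSnoc S A n x).upTo k.castSucc = x.1.upTo k := by
  refine Prod.ext ?_ ?_
  · funext i
    exact histSnoc_fst_castSucc x (Fin.castLE (by omega) i)
  · funext i
    exact histSnoc_snd_castSucc x (Fin.castLE (by omega) i)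

theorem histSnoc_upTo_last {n : ℕ} (x : Hist S A n × (A × Option S)) :
    (histSnoc S A n x).upTo (Fin.last n) = x.1 := by
  refine Prod.ext ?_ ?_
  · funext i
    exact histSnoc_fst_castSucc x i
  · funext i
    exact histSnoc_snd_castSucc x i

end Snoc

/-! ### Weighted transition operators and exponential moments -/

variable {S A : Type*} [Fintype S] [Fintype A]

/-- The exponentially weighted transition operator `f ↦ ∑ s', p(s,a,s') e^{-β r(s,a,s')} f(s')`. -/
def kern (M : FinMDP S A) (β : ℝ) (a : A) (f : Option S → ℝ) (s : Option S) : ℝ :=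
  ∑ s', M.p s a s' * Real.exp (-β * M.r s a s') * f s'

/-- `E[exp(-β X) f(s_n)]`, where `X` is the total reward of the first `n` steps. -/
def phi (M : FinMDP S A) (ν : Option S → ℝ) (π : HistPolicy S A) (β : ℝ) (n : ℕ)
    (f : Option S → ℝ) : ℝ :=
  ∑ ω : Hist S A n, M.pathProb ν π ω *
    (Real.exp (-β * M.totalReward ω) * f (ω.1 (Fin.last n)))

/-- Indicator of the sink. -/
def sinkInd : Option S → ℝ := fun s => s.elim 1 fun _ => 0

/-- Indicator of the non-sink states. -/
def liveInd : Option S → ℝ := fun s => s.elim 0 fun _ => 1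

theorem pathProb_histSnoc (M : FinMDP S A) (ν : Option S → ℝ) (π : HistPolicy S A) {n : ℕ}
    (x : Hist S A n × (A × Option S)) :
    M.pathProb ν π (histSnoc S A n x) = M.pathProb ν π x.1 *
      (π.prob n x.1 x.2.1 * M.p (x.1.1 (Fin.last n)) x.2.1 x.2.2) := by
  unfold pathProb
  rw [Fin.prod_univ_castSucc, ← mul_assoc]
  have h0 : (histSnoc S A n x).1 0 = x.1.1 0 := histSnoc_fst_castSucc x 0
  have h1 : ∀ k : Fin n, (histSnoc S A n x).1 k.castSucc.succ = x.1.1 k.succ := fun k =>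
    histSnoc_fst_castSucc x k.succ
  have h2 := histSnoc_upTo_last x
  have h3 : (histSnoc S A n x).1 (Fin.last n).succ = x.2.2 := histSnoc_fst_last x
  rw [h0, h3, histSnoc_fst_castSucc, histSnoc_snd_last]
  congr 1
  · congr 1
    refine Finset.prod_congr rfl fun k _ => ?_
    rw [h1, histSnoc_fst_castSucc, histSnoc_snd_castSucc]
    have := histSnoc_upTo_castSucc x k
    congr 1
    exact congrArg (fun h => π.prob k h (x.1.2 k)) this
  · congr 1
    exact congrArg (fun h => π.prob n h x.2.1) h2

theorem totalReward_histSnoc (M : FinMDP S A) {n : ℕ} (x : Hist S A n × (A × Option S)) :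
    M.totalReward (histSnoc S A n x) =
      M.totalReward x.1 + M.r (x.1.1 (Fin.last n)) x.2.1 x.2.2 := by
  unfold totalReward
  rw [Fin.sum_univ_castSucc]
  have h1 : ∀ k : Fin n, (histSnoc S A n x).1 k.castSucc.succ = x.1.1 k.succ := fun k =>
    histSnoc_fst_castSucc x k.succ
  have h3 : (histSnoc S A n x).1 (Fin.last n).succ = x.2.2 := histSnoc_fst_last x
  simp only [h1, h3, histSnoc_fst_castSucc, histSnoc_snd_last, histSnoc_snd_castSucc]

theorem phi_succ (M : FinMDP S A) (ν : Option S → ℝ) (π : HistPolicy S A) (β : ℝ) (n : ℕ)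
    (f : Option S → ℝ) :
    M.phi ν π β (n + 1) f = ∑ ω : Hist S A n, M.pathProb ν π ω *
      (Real.exp (-β * M.totalReward ω) *
        ∑ a, π.prob n ω a * M.kern β a f (ω.1 (Fin.last n))) := by
  unfold phi kern
  rw [← (histSnoc S A n).sum_comp, Fintype.sum_prod_type]
  refine Finset.sum_congr rfl fun ω _ => ?_
  rw [Fintype.sum_prod_type, Finset.mul_sum, Finset.mul_sum]
  refine Finset.sum_congr rfl fun a _ => ?_
  rw [Finset.mul_sum, Finset.mul_sum, Finset.mul_sum]
  refine Finset.sum_congr rfl fun s _ => ?_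
  rw [pathProb_histSnoc, totalReward_histSnoc, histSnoc_fst_last, mul_add, Real.exp_add]
  ring

theorem phi_zero (M : FinMDP S A) (ν : Option S → ℝ) (π : HistPolicy S A) (β : ℝ)
    (f : Option S → ℝ) : M.phi ν π β 0 f = ∑ s, ν s * f s := by
  unfold phi pathProb totalReward
  rw [Fintype.sum_prod_type, ← (Equiv.funUnique (Fin 1) (Option S)).sum_comp]
  refine Finset.sum_congr rfl fun x _ => ?_
  simp

theorem pathProb_nonneg (M : FinMDP S A) {ν : Option S → ℝ} (hν : ∀ s, 0 ≤ ν s)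
    (π : HistPolicy S A) {n : ℕ} (ω : Hist S A n) : 0 ≤ M.pathProb ν π ω :=
  mul_nonneg (hν _) (Finset.prod_nonneg fun _ _ =>
    mul_nonneg ((π.prob_mem _ _).1 _) ((M.p_mem _ _).1 _))

theorem kern_mono (M : FinMDP S A) (β : ℝ) (a : A) {f f' : Option S → ℝ} (h : ∀ s, f s ≤ f' s)
    (s : Option S) : M.kern β a f s ≤ M.kern β a f' s :=
  Finset.sum_le_sum fun _ _ => mul_le_mul_of_nonneg_left (h _)
    (mul_nonneg ((M.p_mem _ _).1 _) (Real.exp_nonneg _))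

theorem kern_nonneg (M : FinMDP S A) (β : ℝ) (a : A) {f : Option S → ℝ} (h : ∀ s, 0 ≤ f s)
    (s : Option S) : 0 ≤ M.kern β a f s :=
  Finset.sum_nonneg fun _ _ =>
    mul_nonneg (mul_nonneg ((M.p_mem _ _).1 _) (Real.exp_nonneg _)) (h _)

theorem kern_none (M : FinMDP S A) (β : ℝ) (a : A) (f : Option S → ℝ) :
    M.kern β a f none = f none := by
  have h0 : ∀ s : S, M.p none a (some s) = 0 := by
    have h1 := (M.p_mem none a).2
    rw [Fintype.sum_option, M.p_sink a] at h1
    have h2 : ∑ s : S, M.p none a (some s) = 0 := by linarith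
    intro s
    exact (Finset.sum_eq_zero_iff_of_nonneg fun s _ => (M.p_mem none a).1 (some s)).1 h2 s
      (Finset.mem_univ s)
  unfold kern
  rw [Fintype.sum_option]
  simp [h0, M.p_sink, M.r_sink]

theorem kern_zero_one (M : FinMDP S A) (a : A) (s : Option S) :
    M.kern 0 a (fun _ => 1) s = 1 := by
  simpa [kern] using (M.p_mem s a).2

theorem kern_tendsto (M : FinMDP S A) (β : ℝ) (a : A) {f : ℕ → Option S → ℝ} {f' : Option S → ℝ}
    (h : ∀ s, Tendsto (fun n => f n s) atTop (𝓝 (f' s))) (s : Option S) :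
    Tendsto (fun n => M.kern β a (f n) s) atTop (𝓝 (M.kern β a f' s)) :=
  tendsto_finsetSum _ fun s' _ => (h s').const_mul _

theorem phi_mono (M : FinMDP S A) {ν : Option S → ℝ} (hν : ∀ s, 0 ≤ ν s) (π : HistPolicy S A)
    (β : ℝ) (n : ℕ) {f f' : Option S → ℝ} (h : ∀ s, f s ≤ f' s) :
    M.phi ν π β n f ≤ M.phi ν π β n f' :=
  Finset.sum_le_sum fun _ _ => mul_le_mul_of_nonneg_left
    (mul_le_mul_of_nonneg_left (h _) (Real.exp_nonneg _)) (M.pathProb_nonneg hν π _)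

theorem phi_add (M : FinMDP S A) (ν : Option S → ℝ) (π : HistPolicy S A)
    (β : ℝ) (n : ℕ) (f f' : Option S → ℝ) :
    M.phi ν π β n (fun s => f s + f' s) = M.phi ν π β n f + M.phi ν π β n f' := by
  unfold phi
  rw [← Finset.sum_add_distrib]
  exact Finset.sum_congr rfl fun _ _ => by ring

theorem phi_const_mul (M : FinMDP S A) (ν : Option S → ℝ) (π : HistPolicy S A)
    (β : ℝ) (n : ℕ) (c : ℝ) (f : Option S → ℝ) :
    M.phi ν π β n (fun s => c * f s) = c * M.phi ν π β n f := by
  unfold phi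
  rw [Finset.mul_sum]
  exact Finset.sum_congr rfl fun _ _ => by ring

theorem phi_nonneg (M : FinMDP S A) {ν : Option S → ℝ} (hν : ∀ s, 0 ≤ ν s) (π : HistPolicy S A)
    (β : ℝ) (n : ℕ) {f : Option S → ℝ} (h : ∀ s, 0 ≤ f s) : 0 ≤ M.phi ν π β n f :=
  Finset.sum_nonneg fun _ _ =>
    mul_nonneg (M.pathProb_nonneg hν π _) (mul_nonneg (Real.exp_nonneg _) (h _))

/-- Conditionally on the history, the next step averages `kern β a f'` over the randomized action,
so a bound valid for every action survives. The policy enters no other way. -/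
theorem phi_le_phi_succ (M : FinMDP S A) {ν : Option S → ℝ} (hν : ∀ s, 0 ≤ ν s)
    (π : HistPolicy S A) {β : ℝ} (n : ℕ) {f f' : Option S → ℝ}
    (h : ∀ a s, f s ≤ M.kern β a f' s) : M.phi ν π β n f ≤ M.phi ν π β (n + 1) f' := by
  rw [phi_succ]
  refine Finset.sum_le_sum fun ω _ => mul_le_mul_of_nonneg_left
    (mul_le_mul_of_nonneg_left ?_ (Real.exp_nonneg _)) (M.pathProb_nonneg hν π _)
  calc f (ω.1 (Fin.last n)) = ∑ a, π.prob n ω a * f (ω.1 (Fin.last n)) := by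
        rw [← Finset.sum_mul, (π.prob_mem n ω).2, one_mul]
    _ ≤ _ := Finset.sum_le_sum fun a _ =>
        mul_le_mul_of_nonneg_left (h a _) ((π.prob_mem n ω).1 a)

theorem phi_succ_le_phi (M : FinMDP S A) {ν : Option S → ℝ} (hν : ∀ s, 0 ≤ ν s)
    (π : HistPolicy S A) {β : ℝ} (n : ℕ) {f f' : Option S → ℝ}
    (h : ∀ a s, M.kern β a f' s ≤ f s) : M.phi ν π β (n + 1) f' ≤ M.phi ν π β n f := by
  rw [phi_succ]
  refine Finset.sum_le_sum fun ω _ => mul_le_mul_of_nonneg_left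
    (mul_le_mul_of_nonneg_left ?_ (Real.exp_nonneg _)) (M.pathProb_nonneg hν π _)
  calc _ ≤ ∑ a, π.prob n ω a * f (ω.1 (Fin.last n)) := Finset.sum_le_sum fun a _ =>
        mul_le_mul_of_nonneg_left (h a _) ((π.prob_mem n ω).1 a)
    _ = f (ω.1 (Fin.last n)) := by
        rw [← Finset.sum_mul, (π.prob_mem n ω).2, one_mul]

theorem phi_stationary_succ (M : FinMDP S A) (ν : Option S → ℝ) (d : Option S → A) (β : ℝ) (n : ℕ)
    (f : Option S → ℝ) :
    M.phi ν (HistPolicy.stationary d) β (n + 1) f =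
      M.phi ν (HistPolicy.stationary d) β n (fun s => M.kern β (d s) f s) := by
  classical
  rw [phi_succ]
  unfold phi
  refine Finset.sum_congr rfl fun ω _ => ?_
  congr 2
  rw [Finset.sum_eq_single (d (ω.1 (Fin.last n)))]
  · simp [HistPolicy.stationary]
  · intro a _ ha
    simp [HistPolicy.stationary, ha]
  · simp

theorem phi_stationary (M : FinMDP S A) (ν : Option S → ℝ) (d : Option S → A) (β : ℝ) (n : ℕ)
    (f : Option S → ℝ) :
    M.phi ν (HistPolicy.stationary d) β n f =
      ∑ s, ν s * (fun f s => M.kern β (d s) f s)^[n] f s := by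
  induction n generalizing f with
  | zero => rw [phi_zero]; rfl
  | succ n ih => rw [phi_stationary_succ, ih, Function.iterate_succ_apply]

theorem phi_zero_one (M : FinMDP S A) {ν : Option S → ℝ} (hν : ν ∈ stdSimplex ℝ (Option S))
    (π : HistPolicy S A) (n : ℕ) : M.phi ν π 0 n (fun _ => 1) = 1 := by
  induction n with
  | zero => rw [phi_zero]; simpa using hν.2
  | succ n ih =>
    refine Eq.trans ?_ ih
    exact le_antisymm (M.phi_succ_le_phi hν.1 π n fun a s => (M.kern_zero_one a s).le)
      (M.phi_le_phi_succ hν.1 π n fun a s => (M.kern_zero_one a s).ge)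

theorem sum_pathProb (M : FinMDP S A) {ν : Option S → ℝ} (hν : ν ∈ stdSimplex ℝ (Option S))
    (π : HistPolicy S A) (n : ℕ) : ∑ ω : Hist S A n, M.pathProb ν π ω = 1 := by
  simpa [phi] using M.phi_zero_one hν π n

theorem sum_stateProb (M : FinMDP S A) (π : HistPolicy S A) (s : Option S) (t : ℕ) :
    ∑ s' : S, M.stateProb π s t (some s') =
      M.phi (by classical exact Pi.single s 1) π 0 t liveInd := by
  classical
  unfold stateProb phi
  rw [Finset.sum_comm]
  refine Finset.sum_congr rfl fun ω _ => ?_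
  rcases h : ω.1 (Fin.last t) with _ | x
  · simp [liveInd]
  · simp only [Option.some.injEq, Finset.sum_ite_eq, Finset.mem_univ, if_true, liveInd]
    simp

end FinMDP
end

/-! ### Value iteration and uniform absorption -/

noncomputable section

namespace FinMDP

theorem sinkInd_nonneg {S : Type*} (s : Option S) : 0 ≤ sinkInd s := by
  cases s <;> simp [sinkInd]

theorem liveInd_nonneg {S : Type*} (s : Option S) : 0 ≤ liveInd s := by
  cases s <;> simp [liveInd]

theorem liveInd_le_one {S : Type*} (s : Option S) : liveInd s ≤ 1 := by
  cases s <;> simp [liveInd]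

theorem sinkInd_add_liveInd {S : Type*} (s : Option S) : sinkInd s + liveInd s = 1 := by
  cases s <;> simp [liveInd, sinkInd]

end FinMDP

/-- If at every time one of finitely many convergent sequences is at most `c`, then so is one of
their limits. -/
theorem exists_le_of_tendsto_of_forall_exists_le {ι : Type*} [Finite ι] {x : ℕ → ι → ℝ} {x' : ι → ℝ}
    {c : ℝ} (hx : ∀ i, Tendsto (fun n => x n i) atTop (𝓝 (x' i))) (h : ∀ n, ∃ i, x n i ≤ c) :
    ∃ i, x' i ≤ c := by
  by_contra! hc
  have h1 : ∀ᶠ n in atTop, ∀ i, c < x n i :=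
    eventually_all.2 fun i => (hx i).eventually (lt_mem_nhds (hc i))
  obtain ⟨n, hn⟩ := h1.exists
  obtain ⟨i, hi⟩ := h n
  exact absurd (hn i) (not_lt.2 hi)

namespace FinMDP

variable {S A : Type*} [Fintype S] [Fintype A]

/-- The maximal probability of being in a non-sink state after `n` steps. -/
def liveMax (M : FinMDP S A) : ℕ → Option S → ℝ
  | 0 => liveInd
  | n + 1 => fun s => ⨆ a, M.kern 0 a (M.liveMax n) s

/-- The minimal value of `E[exp(-β X); s_n = e]` after `n` steps. -/
def sinkMin (M : FinMDP S A) (β : ℝ) : ℕ → Option S → ℝ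
  | 0 => sinkInd
  | n + 1 => fun s => ⨅ a, M.kern β a (M.sinkMin β n) s

theorem kern_le_liveMax (M : FinMDP S A) (n : ℕ) (a : A) (s : Option S) :
    M.kern 0 a (M.liveMax n) s ≤ M.liveMax (n + 1) s :=
  le_ciSup (f := fun a => M.kern 0 a (M.liveMax n) s) (Set.finite_range _).bddAbove a

theorem sinkMin_le_kern (M : FinMDP S A) (β : ℝ) (n : ℕ) (a : A) (s : Option S) :
    M.sinkMin β (n + 1) s ≤ M.kern β a (M.sinkMin β n) s :=
  ciInf_le (f := fun a => M.kern β a (M.sinkMin β n) s) (Set.finite_range _).bddBelow a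

theorem exists_kern_eq_liveMax [Nonempty A] (M : FinMDP S A) (n : ℕ) (s : Option S) :
    ∃ a, M.kern 0 a (M.liveMax n) s = M.liveMax (n + 1) s :=
  exists_eq_ciSup_of_finite (f := fun a => M.kern 0 a (M.liveMax n) s)

theorem exists_kern_eq_sinkMin [Nonempty A] (M : FinMDP S A) (β : ℝ) (n : ℕ) (s : Option S) :
    ∃ a, M.kern β a (M.sinkMin β n) s = M.sinkMin β (n + 1) s :=
  exists_eq_ciInf_of_finite (f := fun a => M.kern β a (M.sinkMin β n) s)

theorem liveMax_nonneg [Nonempty A] (M : FinMDP S A) (n : ℕ) (s : Option S) :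
    0 ≤ M.liveMax n s := by
  induction n generalizing s with
  | zero => exact liveInd_nonneg s
  | succ n ih =>
    obtain ⟨a, ha⟩ := M.exists_kern_eq_liveMax n s
    exact ha ▸ M.kern_nonneg 0 a ih s

theorem liveMax_none [Nonempty A] (M : FinMDP S A) (n : ℕ) : M.liveMax n none = 0 := by
  induction n with
  | zero => rfl
  | succ n ih =>
    obtain ⟨a, ha⟩ := M.exists_kern_eq_liveMax n none
    rw [← ha, kern_none, ih]

theorem liveMax_succ_le [Nonempty A] (M : FinMDP S A) (n : ℕ) (s : Option S) :
    M.liveMax (n + 1) s ≤ M.liveMax n s := by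
  induction n generalizing s with
  | zero =>
    obtain ⟨a, ha⟩ := M.exists_kern_eq_liveMax 0 s
    rw [← ha]
    cases s with
    | none => rw [kern_none]
    | some s =>
      refine (M.kern_mono 0 a liveInd_le_one (some s)).trans ?_
      rw [kern_zero_one]
      rfl
  | succ n ih =>
    obtain ⟨a, ha⟩ := M.exists_kern_eq_liveMax (n + 1) s
    rw [← ha]
    exact (M.kern_mono 0 a ih s).trans (M.kern_le_liveMax n a s)

theorem liveMax_le_one [Nonempty A] (M : FinMDP S A) (n : ℕ) (s : Option S) :
    M.liveMax n s ≤ 1 :=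
  (antitone_nat_of_succ_le (f := fun n => M.liveMax n s) (fun n => M.liveMax_succ_le n s)
    (Nat.zero_le n)).trans (liveInd_le_one s)

theorem sinkMin_none [Nonempty A] (M : FinMDP S A) (β : ℝ) (n : ℕ) : M.sinkMin β n none = 1 := by
  induction n with
  | zero => rfl
  | succ n ih =>
    obtain ⟨a, ha⟩ := M.exists_kern_eq_sinkMin β n none
    rw [← ha, kern_none, ih]

theorem sinkMin_le_succ [Nonempty A] (M : FinMDP S A) (β : ℝ) (n : ℕ) (s : Option S) :
    M.sinkMin β n s ≤ M.sinkMin β (n + 1) s := by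
  induction n generalizing s with
  | zero =>
    obtain ⟨a, ha⟩ := M.exists_kern_eq_sinkMin β 0 s
    rw [← ha]
    cases s with
    | none => rw [kern_none]
    | some s => exact M.kern_nonneg β a sinkInd_nonneg _
  | succ n ih =>
    obtain ⟨a, ha⟩ := M.exists_kern_eq_sinkMin β (n + 1) s
    rw [← ha]
    exact (M.sinkMin_le_kern β n a s).trans (M.kern_mono β a ih s)

theorem sinkMin_nonneg [Nonempty A] (M : FinMDP S A) (β : ℝ) (n : ℕ) (s : Option S) :
    0 ≤ M.sinkMin β n s :=
  (sinkInd_nonneg s).trans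
    (monotone_nat_of_le_succ (f := fun n => M.sinkMin β n s) (fun n => M.sinkMin_le_succ β n s)
      (Nat.zero_le n))

/-- Transience passes from stationary deterministic policies to uniform absorption. -/
theorem exists_liveMax_le_half [Nonempty A] (M : FinMDP S A) (htrans : M.IsTransient) :
    ∃ N, ∀ s, M.liveMax N s ≤ 1 / 2 := by
  classical
  have hanti : ∀ s, Antitone fun n => M.liveMax n s := fun s =>
    antitone_nat_of_succ_le fun n => M.liveMax_succ_le n s
  have hbdd : ∀ s, BddBelow (Set.range fun n => M.liveMax n s) := fun s =>
    ⟨0, by rintro _ ⟨n, rfl⟩; exact M.liveMax_nonneg n s⟩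
  set u : Option S → ℝ := fun s => ⨅ n, M.liveMax n s with hu
  have hlim : ∀ s, Tendsto (fun n => M.liveMax n s) atTop (𝓝 (u s)) := fun s =>
    tendsto_atTop_ciInf (hanti s) (hbdd s)
  have hule : ∀ n s, u s ≤ M.liveMax n s := fun n s => ciInf_le (hbdd s) n
  -- The maximizing action may vary with `n`, but there are finitely many actions, so one of them
  -- satisfies the inequality in the limit. The signs are flipped to fit the selection lemma.
  have hd : ∀ s, ∃ a, u s ≤ M.kern 0 a u s := fun s => by
    obtain ⟨a, ha⟩ := exists_le_of_tendsto_of_forall_exists_le (c := - u s)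
      (x := fun n a => - M.kern 0 a (M.liveMax n) s) (fun a => (M.kern_tendsto 0 a hlim s).neg)
      (fun n => by
        obtain ⟨a, ha⟩ := M.exists_kern_eq_liveMax n s
        exact ⟨a, by rw [ha]; exact neg_le_neg (hule _ _)⟩)
    exact ⟨a, neg_le_neg_iff.1 ha⟩
  choose d hd using hd
  have hu0 : ∀ s, u s ≤ 0 := by
    intro s
    cases s with
    | none => exact (hule 0 none).trans (M.liveMax_none 0).le
    | some s =>
      have hν : ∀ x, 0 ≤ (Pi.single (some s) 1 : Option S → ℝ) x :=
        (single_mem_stdSimplex ℝ (some s)).1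
      -- Since `u` is subharmonic under `d`, it bounds the survival probability from below at all
      -- times; transience of `d` then forces it to be nonpositive.
      have hbound : ∀ t, u (some s) ≤
          M.phi (Pi.single (some s) 1) (HistPolicy.stationary d) 0 t liveInd := by
        intro t
        refine le_trans ?_ (M.phi_mono hν _ 0 t (hule 0))
        induction t with
        | zero =>
          rw [phi_zero, Finset.sum_eq_single (some s)]
          · simp
          · intro b _ hb
            simp [hb]
          · simp
        | succ t ih =>
          rw [phi_stationary_succ]
          exact ih.trans (M.phi_mono hν _ 0 t hd)
      have hto : Tendsto (fun t => M.phi (Pi.single (some s) 1) (HistPolicy.stationary d) 0 t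
          liveInd) atTop (𝓝 0) := by
        have h1 : Tendsto (fun t => ∑ s' : S, M.stateProb (HistPolicy.stationary d) (some s) t
            (some s')) atTop (𝓝 (∑ s' : S, 0)) :=
          tendsto_finsetSum _ fun s' _ => (htrans d s s').tendsto_atTop_zero
        rw [Finset.sum_const_zero] at h1
        refine h1.congr fun t => ?_
        rw [sum_stateProb]
      exact ge_of_tendsto' hto hbound
  have hev : ∀ᶠ n in atTop, ∀ s, M.liveMax n s < 1 / 2 :=
    eventually_all.2 fun s => (hlim s).eventually (gt_mem_nhds ((hu0 s).trans_lt (by norm_num)))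
  obtain ⟨N, hN⟩ := hev.exists
  exact ⟨N, fun s => (hN s).le⟩

theorem exists_reward_bound (M : FinMDP S A) : ∃ c, 0 ≤ c ∧ ∀ s a s', |M.r s a s'| ≤ c := by
  obtain ⟨c, hc⟩ := (Set.finite_range fun x : Option S × A × Option S =>
    |M.r x.1 x.2.1 x.2.2|).bddAbove
  exact ⟨max c 0, le_max_right _ _, fun s a s' =>
    (hc ⟨(s, a, s'), rfl⟩).trans (le_max_left _ _)⟩

theorem phi_one_eq (M : FinMDP S A) (ν : Option S → ℝ) (π : HistPolicy S A) (β : ℝ) (n : ℕ) :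
    M.phi ν π β n (fun _ => 1) = M.phi ν π β n sinkInd + M.phi ν π β n liveInd := by
  rw [← phi_add]
  congr
  funext s
  exact (sinkInd_add_liveInd s).symm

theorem phi_sinkInd_mono (M : FinMDP S A) {ν : Option S → ℝ} (hν : ∀ s, 0 ≤ ν s)
    (π : HistPolicy S A) (β : ℝ) : Monotone fun n => M.phi ν π β n sinkInd := by
  refine monotone_nat_of_le_succ fun n => M.phi_le_phi_succ hν π n fun a s => ?_
  cases s with
  | none => rw [kern_none]
  | some s => exact M.kern_nonneg β a sinkInd_nonneg _

/-- Within `N` further steps, a fixed fraction of the surviving weight is absorbed. -/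
theorem exists_absorption (M : FinMDP S A) [Nonempty A] (htrans : M.IsTransient) (β : ℝ) :
    ∃ N : ℕ, ∃ κ : ℝ, 0 < κ ∧ ∀ (ν : Option S → ℝ), (∀ s, 0 ≤ ν s) → ∀ (π : HistPolicy S A) (t : ℕ),
      M.phi ν π β t sinkInd + κ * M.phi ν π β t liveInd ≤ M.phi ν π β (t + N) sinkInd := by
  obtain ⟨N, hN⟩ := M.exists_liveMax_le_half htrans
  obtain ⟨c, hc, hr⟩ := M.exists_reward_bound
  -- A lower bound for every one-step weight, so `n` steps cost at most a factor `q ^ n`.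
  set q := Real.exp (-(|β| * c)) with hq
  have hq0 : 0 < q := Real.exp_pos _
  have hq1 : q ≤ 1 := by
    rw [hq, Real.exp_le_one_iff, neg_nonpos]
    positivity
  have hqr : ∀ s a s', q ≤ Real.exp (-β * M.r s a s') := fun s a s' => by
    apply Real.exp_le_exp.2
    have h1 := neg_abs_le (β * M.r s a s')
    have h2 := le_abs_self (β * M.r s a s')
    rw [abs_mul] at h1 h2
    have := mul_le_mul_of_nonneg_left (hr s a s') (abs_nonneg β)
    linarith
  -- A lower bound for the weight absorbed within `n` steps: absorption probability at least `1 -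
  -- liveMax n`, discounted by `q ^ n` off the sink.
  set z : ℕ → Option S → ℝ := fun n s =>
    sinkInd s + liveInd s * (q ^ n * (1 - M.liveMax n s)) with hz
  have hz_ge : ∀ n s, q ^ n * (1 - M.liveMax n s) ≤ z n s := by
    intro n s
    cases s with
    | none => simpa [hz, sinkInd, liveInd, liveMax_none] using pow_le_one₀ hq0.le hq1
    | some s => simp [hz, sinkInd, liveInd]
  have hstep : ∀ n a s, z (n + 1) s ≤ M.kern β a (z n) s := by
    intro n a s
    cases s with
    | none => rw [kern_none]; simp [hz, sinkInd, liveInd]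
    | some s =>
      have h1 : q ^ (n + 1) * (1 - M.kern 0 a (M.liveMax n) (some s)) ≤
          M.kern β a (z n) (some s) := by
        rw [← M.kern_zero_one a (some s)]
        unfold kern
        rw [← Finset.sum_sub_distrib, Finset.mul_sum]
        refine Finset.sum_le_sum fun s' _ => ?_
        have hp := (M.p_mem (some s) a).1 s'
        have hl := M.liveMax_le_one n s'
        calc _ = M.p (some s) a s' * q * (q ^ n * (1 - M.liveMax n s')) := by
              simp only [neg_zero, zero_mul, Real.exp_zero]; ring
          _ ≤ M.p (some s) a s' * Real.exp (-β * M.r (some s) a s') *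
              (q ^ n * (1 - M.liveMax n s')) :=
            mul_le_mul_of_nonneg_right (mul_le_mul_of_nonneg_left (hqr _ _ _) hp)
              (mul_nonneg (pow_nonneg hq0.le n) (by linarith))
          _ ≤ _ := mul_le_mul_of_nonneg_left (hz_ge n s') (mul_nonneg hp (Real.exp_nonneg _))
      refine le_trans ?_ h1
      have h2 := M.kern_le_liveMax n a (some s)
      have h3 : 0 ≤ q ^ (n + 1) := pow_nonneg hq0.le _
      simp only [hz, sinkInd, liveInd, Option.elim, zero_add, one_mul]
      exact mul_le_mul_of_nonneg_left (by linarith) h3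
  refine ⟨N, q ^ N * (1 / 2), by positivity, fun ν hν π t => ?_⟩
  have hchain : ∀ n, M.phi ν π β t (z n) ≤ M.phi ν π β (t + n) (z 0) := by
    intro n
    -- The free index `m` is needed because each step of time lowers the remaining horizon by one.
    have : ∀ m, M.phi ν π β t (z (n + m)) ≤ M.phi ν π β (t + n) (z m) := by
      induction n with
      | zero => intro m; simp
      | succ n ih =>
        intro m
        have h1 := ih (m + 1)
        rw [show n + 1 + m = n + (m + 1) by ring]
        exact h1.trans (M.phi_le_phi_succ hν π (t + n) (hstep m))
    exact this 0
  have hz0 : z 0 = sinkInd := by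
    funext s
    cases s <;> simp [hz, sinkInd, liveInd, liveMax]
  rw [← hz0]
  refine le_trans ?_ (hchain N)
  rw [hz0, ← phi_const_mul, ← phi_add]
  refine M.phi_mono hν π β t fun s => ?_
  have h1 := hN s
  simp only [hz]
  have h2 : q ^ N * (1 / 2) ≤ q ^ N * (1 - M.liveMax N s) :=
    mul_le_mul_of_nonneg_left (by linarith) (pow_nonneg hq0.le _)
  have h3 := mul_le_mul_of_nonneg_right h2 (liveInd_nonneg s)
  linarith

/-! ### Convergence and uniform bounds of exponential moments -/

/-- If the absorbed weight stays bounded then the total weight converges. -/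
theorem phi_one_tendsto_of_bdd [Nonempty A] (M : FinMDP S A) (htrans : M.IsTransient) (β : ℝ)
    {ν : Option S → ℝ} (hν : ∀ s, 0 ≤ ν s) (π : HistPolicy S A) {C : ℝ}
    (hC : ∀ t, M.phi ν π β t sinkInd ≤ C) :
    ∃ D ≤ C, Tendsto (fun t => M.phi ν π β t (fun _ => 1)) atTop (𝓝 D) := by
  obtain ⟨N, κ, hκ, h⟩ := M.exists_absorption htrans β
  have hmono := M.phi_sinkInd_mono hν π β
  have hlim := tendsto_atTop_ciSup hmono ⟨C, by rintro _ ⟨t, rfl⟩; exact hC t⟩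
  refine ⟨_, ciSup_le hC, ?_⟩
  -- By absorption, the live weight is at most `κ⁻¹` times an increment of a convergent sequence.
  have hlive : Tendsto (fun t => M.phi ν π β t liveInd) atTop (𝓝 0) := by
    have h1 : Tendsto (fun t => κ⁻¹ * (M.phi ν π β (t + N) sinkInd - M.phi ν π β t sinkInd))
        atTop (𝓝 0) := by
      have := ((hlim.comp (tendsto_add_atTop_nat N)).sub hlim).const_mul κ⁻¹
      simpa using this
    refine squeeze_zero (fun t => M.phi_nonneg hν π β t liveInd_nonneg) (fun t => ?_) h1
    rw [le_inv_mul_iff₀ hκ]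
    have := h ν hν π t
    linarith
  have := hlim.add hlive
  rw [add_zero] at this
  exact this.congr fun t => (M.phi_one_eq ν π β t).symm

/-- The absorbed weight is monotone and lies below the total weight, so if it is unbounded it drags
the total weight to infinity. -/
theorem phi_one_tendsto [Nonempty A] (M : FinMDP S A) (htrans : M.IsTransient) (β : ℝ)
    {ν : Option S → ℝ} (hν : ∀ s, 0 ≤ ν s) (π : HistPolicy S A) :
    (∃ D, Tendsto (fun t => M.phi ν π β t (fun _ => 1)) atTop (𝓝 D)) ∨
      Tendsto (fun t => M.phi ν π β t (fun _ => 1)) atTop atTop := by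
  by_cases hb : ∃ C, ∀ t, M.phi ν π β t sinkInd ≤ C
  · obtain ⟨C, hC⟩ := hb
    obtain ⟨D, -, hD⟩ := M.phi_one_tendsto_of_bdd htrans β hν π hC
    exact Or.inl ⟨D, hD⟩
  · right
    push Not at hb
    refine tendsto_atTop_mono (fun t => ?_) (tendsto_atTop_atTop_of_monotone
      (M.phi_sinkInd_mono hν π β) fun C => (hb C).imp fun t ht => ht.le)
    exact M.phi_mono hν π β t fun s => by
      have := sinkInd_add_liveInd s
      have := liveInd_nonneg s
      linarith

/-- Exponential moments of the total reward are bounded, uniformly in policies and horizons. -/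
theorem exists_phi_one_le [Nonempty A] (M : FinMDP S A) (htrans : M.IsTransient)
    {ν : Option S → ℝ} (hν : ν ∈ stdSimplex ℝ (Option S)) :
    ∃ l C : ℝ, 0 < l ∧ 1 ≤ C ∧ ∀ β, |β| ≤ l → ∀ (π : HistPolicy S A) (t : ℕ),
      M.phi ν π β t (fun _ => 1) ≤ C := by
  obtain ⟨N, hN⟩ := M.exists_liveMax_le_half htrans
  obtain ⟨c, hc, hr⟩ := M.exists_reward_bound
  -- A Lyapunov function: the sum telescopes under one step, so on live states `τ` drops by at least
  -- `liveMax 0 - liveMax N ≥ 1 / 2`.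
  set τ : Option S → ℝ := fun s => ∑ n ∈ Finset.range N, M.liveMax n s with hτ
  have hτ0 : ∀ s, 0 ≤ τ s := fun s => Finset.sum_nonneg fun n _ => M.liveMax_nonneg n s
  have hτN : ∀ s, τ s ≤ N := fun s => by
    simpa using Finset.sum_le_sum fun n (_ : n ∈ Finset.range N) => M.liveMax_le_one n s
  have hτnone : τ none = 0 := Finset.sum_eq_zero fun n _ => M.liveMax_none n
  have hτstep : ∀ a (s : S), M.kern 0 a τ (some s) ≤ τ (some s) - 1 / 2 := by
    intro a s
    have h1 : M.kern 0 a τ (some s) =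
        ∑ n ∈ Finset.range N, M.kern 0 a (M.liveMax n) (some s) := by
      unfold kern
      rw [Finset.sum_comm]
      exact Finset.sum_congr rfl fun s' _ => by rw [hτ, Finset.mul_sum]
    have h2 : M.kern 0 a τ (some s) ≤ ∑ n ∈ Finset.range N, M.liveMax (n + 1) (some s) := by
      rw [h1]
      exact Finset.sum_le_sum fun n _ => M.kern_le_liveMax n a (some s)
    have h3 := Finset.sum_range_succ (fun n => M.liveMax n (some s)) N
    rw [Finset.sum_range_succ'] at h3
    have h4 : M.liveMax 0 (some s) = 1 := rfl
    have h5 := hN (some s)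
    rw [h4] at h3
    simp only [hτ] at *
    linarith
  -- Chosen so that `ε * (1 / 2 + N) = 1 / 2`: the drop of `τ` then compensates a weight of up to `1
  -- + ε` per step, making `1 + τ` a supersolution.
  set ε : ℝ := 1 / (1 + 2 * N) with hε
  have hε0 : 0 < ε := by positivity
  have hlog : 0 < Real.log (1 + ε) := Real.log_pos (by linarith)
  set l : ℝ := Real.log (1 + ε) / (c + 1) with hl
  have hl0 : 0 < l := by positivity
  refine ⟨l, 1 + N, hl0, by simp, fun β hβ π t => ?_⟩
  have hexp : ∀ s a s', Real.exp (-β * M.r s a s') ≤ 1 + ε := by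
    intro s a s'
    rw [← Real.exp_log (show (0 : ℝ) < 1 + ε by positivity)]
    apply Real.exp_le_exp.2
    have h1 : -β * M.r s a s' ≤ |β| * |M.r s a s'| := by
      rw [← abs_mul]
      have := neg_abs_le (β * M.r s a s')
      linarith
    have h2 : |β| * |M.r s a s'| ≤ l * (c + 1) :=
      mul_le_mul hβ ((hr s a s').trans (by linarith)) (abs_nonneg _) hl0.le
    have h3 : l * (c + 1) = Real.log (1 + ε) := by
      rw [hl]
      field_simp
    linarith
  have hstep : ∀ a s, M.kern β a (fun s => 1 + τ s) s ≤ 1 + τ s := by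
    intro a s
    cases s with
    | none => rw [kern_none]
    | some s =>
      have h1 : M.kern β a (fun s => 1 + τ s) (some s) ≤
          (1 + ε) * (M.kern 0 a (fun _ => 1) (some s) + M.kern 0 a τ (some s)) := by
        unfold kern
        rw [← Finset.sum_add_distrib, Finset.mul_sum]
        refine Finset.sum_le_sum fun s' _ => ?_
        have hp := (M.p_mem (some s) a).1 s'
        calc _ ≤ M.p (some s) a s' * (1 + ε) * (1 + τ s') :=
              mul_le_mul_of_nonneg_right (mul_le_mul_of_nonneg_left (hexp _ _ _) hp)
                (by linarith [hτ0 s'])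
          _ = _ := by simp only [neg_zero, zero_mul, Real.exp_zero]; ring
      rw [kern_zero_one] at h1
      have h2 := hτstep a s
      have h3 : ε * (1 / 2 + τ (some s)) ≤ 1 / 2 := by
        have : ε * (1 / 2 + N) = 1 / 2 := by
          rw [hε]
          field_simp
        rw [← this]
        exact mul_le_mul_of_nonneg_left (by linarith [hτN (some s)]) hε0.le
      have h4 : (1 + ε) * (1 + M.kern 0 a τ (some s)) ≤ (1 + ε) * (1 + (τ (some s) - 1 / 2)) :=
        mul_le_mul_of_nonneg_left (by linarith) (by linarith)
      nlinarith
  have hw : ∀ t, M.phi ν π β t (fun s => 1 + τ s) ≤ 1 + N := by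
    intro t
    induction t with
    | zero =>
      rw [phi_zero]
      calc _ ≤ ∑ s, ν s * (1 + N : ℝ) := Finset.sum_le_sum fun s _ =>
            mul_le_mul_of_nonneg_left (by linarith [hτN s]) (hν.1 s)
        _ = _ := by rw [← Finset.sum_mul, hν.2, one_mul]
    | succ t ih => exact (M.phi_succ_le_phi hν.1 π t hstep).trans ih
  exact (M.phi_mono hν.1 π β t fun s => by linarith [hτ0 s]).trans (hw t)

/-! ### Optimality of stationary deterministic policies -/

/-- If some sequence of policies keeps the exponential moment below `C`, then a stationary
deterministic policy does so in the limit. -/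
theorem exists_stationary_tendsto_le [Nonempty A] (M : FinMDP S A) (htrans : M.IsTransient)
    (hinit : ∀ s : S, 0 < M.init (some s)) (β C : ℝ)
    (h : ∃ᶠ t in atTop, ∃ π, M.phi M.init π β t (fun _ => 1) ≤ C) :
    ∃ d : Option S → A, ∃ D ≤ C,
      Tendsto (fun t => M.phi M.init (HistPolicy.stationary d) β t (fun _ => 1)) atTop (𝓝 D) := by
  have hν := M.init_mem.1
  have hmono : ∀ s, Monotone fun n => M.sinkMin β n s := fun s =>
    monotone_nat_of_le_succ fun n => M.sinkMin_le_succ β n s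
  have hchain : ∀ (π : HistPolicy S A) n,
      ∑ s, M.init s * M.sinkMin β n s ≤ M.phi M.init π β n sinkInd := by
    intro π n
    have : ∀ m, ∑ s, M.init s * M.sinkMin β (n + m) s ≤ M.phi M.init π β n (M.sinkMin β m) := by
      induction n with
      | zero => intro m; rw [phi_zero, Nat.zero_add]
      | succ n ih =>
        intro m
        rw [show n + 1 + m = n + (m + 1) by ring]
        exact (ih (m + 1)).trans (M.phi_le_phi_succ hν π n fun a s => M.sinkMin_le_kern β m a s)
    exact this 0
  have hsum : ∀ n, ∑ s, M.init s * M.sinkMin β n s ≤ C := by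
    intro n
    obtain ⟨t, ⟨π, hπ⟩, ht⟩ := (h.and_eventually (eventually_ge_atTop n)).exists
    calc _ ≤ ∑ s, M.init s * M.sinkMin β t s := Finset.sum_le_sum fun s _ =>
          mul_le_mul_of_nonneg_left (hmono s ht) (hν s)
      _ ≤ _ := hchain π t
      _ ≤ _ := M.phi_mono hν π β t fun s => by
          have := sinkInd_add_liveInd s
          have := liveInd_nonneg s
          linarith
      _ ≤ C := hπ
  -- Positivity of the initial distribution turns the bound on the weighted sum into a bound at each
  -- state.
  have hbdd : ∀ s, BddAbove (Set.range fun n => M.sinkMin β n s) := by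
    intro s
    cases s with
    | none => exact ⟨1, by rintro _ ⟨n, rfl⟩; exact (M.sinkMin_none β n).le⟩
    | some s =>
      refine ⟨C / M.init (some s), ?_⟩
      rintro _ ⟨n, rfl⟩
      simp only
      rw [le_div_iff₀ (hinit s), mul_comm]
      exact (Finset.single_le_sum (f := fun s => M.init s * M.sinkMin β n s)
        (fun s _ => mul_nonneg (hν s) (M.sinkMin_nonneg β n s)) (Finset.mem_univ _)).trans (hsum n)
  set y : Option S → ℝ := fun s => ⨆ n, M.sinkMin β n s with hy
  have hlim : ∀ s, Tendsto (fun n => M.sinkMin β n s) atTop (𝓝 (y s)) := fun s =>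
    tendsto_atTop_ciSup (hmono s) (hbdd s)
  have hley : ∀ n s, M.sinkMin β n s ≤ y s := fun n s => le_ciSup (hbdd s) n
  have hyC : ∑ s, M.init s * y s ≤ C :=
    le_of_tendsto' (tendsto_finsetSum _ fun s _ => (hlim s).const_mul _) hsum
  -- Finiteness of `A` again lets one action serve in the limit. With `y` superharmonic under `d`,
  -- the absorbed weight stays below `C`, and the live weight then vanishes.
  have hd : ∀ s, ∃ a, M.kern β a y s ≤ y s := fun s =>
    exists_le_of_tendsto_of_forall_exists_le (fun a => M.kern_tendsto β a hlim s)
      (fun n => (M.exists_kern_eq_sinkMin β n s).imp fun a ha => ha.le.trans (hley _ _))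
  choose d hd using hd
  refine ⟨d, M.phi_one_tendsto_of_bdd htrans β hν _ fun t => ?_⟩
  refine (M.phi_mono hν _ β t (hley 0)).trans ?_
  induction t with
  | zero => rwa [phi_zero]
  | succ t ih =>
    rw [phi_stationary_succ]
    exact (M.phi_mono hν _ β t hd).trans ih

end FinMDP
end

/-! ### Entropic risk: monotonicity and behaviour near zero -/

noncomputable section

section Erm

variable {Ω : Type*} [Fintype Ω] {P : Ω → ℝ}

theorem sum_mul_exp_pos (hP : P ∈ stdSimplex ℝ Ω) (X : Ω → ℝ) :
    0 < ∑ ω, P ω * Real.exp (X ω) := by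
  refine lt_of_le_of_ne
    (Finset.sum_nonneg fun ω _ => mul_nonneg (hP.1 ω) (Real.exp_nonneg _)) fun h => ?_
  have h1 := (Finset.sum_eq_zero_iff_of_nonneg fun ω _ =>
    mul_nonneg (hP.1 ω) (Real.exp_nonneg (X ω))).1 h.symm
  have h2 : ∑ ω, P ω = 0 := Finset.sum_eq_zero fun ω hω =>
    (mul_eq_zero.1 (h1 ω hω)).resolve_right (Real.exp_ne_zero _)
  rw [hP.2] at h2
  exact one_ne_zero h2

theorem erm_zero (X : Ω → ℝ) : erm P 0 X = ∑ ω, P ω * X ω := if_pos rfl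

theorem erm_of_pos {β : ℝ} (hβ : 0 < β) (X : Ω → ℝ) :
    erm P β X = -β⁻¹ * Real.log (∑ ω, P ω * Real.exp (-β * X ω)) := if_neg hβ.ne'

/-- Jensen for the exponential when `β = 0`, and otherwise the power mean inequality with exponent
`β' / β ≥ 1`. -/
theorem erm_antitone (hP : P ∈ stdSimplex ℝ Ω) (X : Ω → ℝ) {β β' : ℝ} (h0 : 0 ≤ β)
    (h : β ≤ β') : erm P β' X ≤ erm P β X := by
  rcases h0.eq_or_lt with rfl | hβ
  · rcases h.eq_or_lt with rfl | hβ'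
    · exact le_rfl
    rw [erm_zero, erm_of_pos hβ', neg_mul, neg_le, inv_mul_eq_div, le_div_iff₀ hβ',
      Real.le_log_iff_exp_le (sum_mul_exp_pos hP _)]
    have := convexOn_exp.map_sum_le (t := Finset.univ) (w := P) (p := fun ω => -β' * X ω)
      (fun ω _ => hP.1 ω) hP.2 (fun _ _ => Set.mem_univ _)
    simp only [smul_eq_mul] at this
    refine le_of_eq_of_le ?_ this
    rw [← Finset.sum_neg_distrib, Finset.sum_mul]
    congr 1
    exact Finset.sum_congr rfl fun ω _ => by ring
  · have hβ' := hβ.trans_le h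
    rw [erm_of_pos hβ, erm_of_pos hβ', neg_mul, neg_mul, neg_le_neg_iff]
    have hW := sum_mul_exp_pos hP fun ω => -β * X ω
    have h1 := Real.rpow_arith_mean_le_arith_mean_rpow Finset.univ P
      (fun ω => Real.exp (-β * X ω)) (fun ω _ => hP.1 ω) hP.2
      (fun ω _ => Real.exp_nonneg _) ((one_le_div₀ hβ).2 h)
    have h2 : ∀ ω, Real.exp (-β * X ω) ^ (β' / β) = Real.exp (-β' * X ω) := fun ω => by
      rw [← Real.exp_mul]
      congr 1
      field_simp
    simp only [h2] at h1
    have h3 := Real.log_le_log (Real.rpow_pos_of_pos hW _) h1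
    rw [Real.log_rpow hW] at h3
    calc _ = β'⁻¹ * (β' / β * Real.log (∑ ω, P ω * Real.exp (-β * X ω))) := by
          field_simp
      _ ≤ _ := mul_le_mul_of_nonneg_left h3 (inv_nonneg.2 hβ'.le)

theorem exp_le_one_add_add_sq (y : ℝ) : Real.exp y ≤ 1 + y + y ^ 2 * Real.exp |y| := by
  have h := Complex.norm_exp_sub_sum_le_norm_mul_exp (y : ℂ) 2
  have h1 : Complex.exp y - ∑ m ∈ Finset.range 2, (y : ℂ) ^ m / (m.factorial : ℂ) =
      ((Real.exp y - (1 + y) : ℝ) : ℂ) := by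
    simp [Finset.sum_range_succ]
  rw [h1, Complex.norm_real, Complex.norm_real, Real.norm_eq_abs, Real.norm_eq_abs, sq_abs] at h
  linarith [le_abs_self (Real.exp y - (1 + y))]

/-- In the quadratic Taylor remainder, `β ≤ l / 2` leaves half of `exp (l * |x|)` to absorb the
factor `x ^ 2`; the two-sided exponential then dominates `exp (l * |x|)`. -/
theorem exp_neg_mul_le {l β : ℝ} (hβ : 0 < β) (hl : β ≤ l / 2) (x : ℝ) :
    Real.exp (-β * x) ≤ 1 + -β * x +
      8 * β ^ 2 / l ^ 2 * (Real.exp (-(-l) * x) + Real.exp (-l * x)) := by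
  have hl0 : 0 < l := by linarith
  have h1 := exp_le_one_add_add_sq (-β * x)
  have h2 : |-β * x| ≤ l * |x| / 2 := by
    rw [abs_mul, abs_neg, abs_of_pos hβ]
    have := mul_le_mul_of_nonneg_right hl (abs_nonneg x)
    linarith
  have h3 : (l * |x|) ^ 2 / 8 ≤ Real.exp (l * |x| / 2) := by
    have h4 : 0 ≤ l * |x| / 2 := by positivity
    have := Real.quadratic_le_exp_of_nonneg h4
    nlinarith
  have h4 : Real.exp (l * |x|) ≤ Real.exp (-(-l) * x) + Real.exp (-l * x) := by
    rcases abs_cases x with ⟨h, _⟩ | ⟨h, _⟩ <;> rw [h]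
    · rw [neg_neg]
      linarith [Real.exp_pos (-l * x)]
    · rw [mul_neg, ← neg_mul]
      linarith [Real.exp_pos (-(-l) * x)]
  have h5 : (-β * x) ^ 2 * Real.exp |-β * x| ≤ 8 * β ^ 2 / l ^ 2 * Real.exp (l * |x|) := by
    have h6 : (-β * x) ^ 2 = 8 * β ^ 2 / l ^ 2 * ((l * |x|) ^ 2 / 8) := by
      rw [mul_pow l, sq_abs]
      field_simp
    have h7 : Real.exp (l * |x|) = Real.exp (l * |x| / 2) * Real.exp (l * |x| / 2) := by
      rw [← Real.exp_add]
      congr 1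
      ring
    rw [h6, h7, mul_assoc]
    refine mul_le_mul_of_nonneg_left ?_ (by positivity)
    exact mul_le_mul h3 (Real.exp_le_exp.2 h2) (Real.exp_nonneg _) (Real.exp_nonneg _)
  have h6 := mul_le_mul_of_nonneg_left h4 (show 0 ≤ 8 * β ^ 2 / l ^ 2 by positivity)
  linarith

/-- The entropic risk measure with small parameter is close to the expectation. -/
theorem erm_zero_le (hP : P ∈ stdSimplex ℝ Ω) (X : Ω → ℝ) {l C β : ℝ} (hβ : 0 < β)
    (hl : β ≤ l / 2) (h1 : ∑ ω, P ω * Real.exp (-l * X ω) ≤ C)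
    (h2 : ∑ ω, P ω * Real.exp (-(-l) * X ω) ≤ C) :
    erm P 0 X ≤ erm P β X + 16 * C / l ^ 2 * β := by
  rw [erm_zero, erm_of_pos hβ]
  have hW := sum_mul_exp_pos hP fun ω => -β * X ω
  have h3 := Real.log_le_sub_one_of_pos hW
  have h4 : ∑ ω, P ω * Real.exp (-β * X ω) ≤ 1 + -β * ∑ ω, P ω * X ω +
      8 * β ^ 2 / l ^ 2 * (∑ ω, P ω * Real.exp (-(-l) * X ω) +
        ∑ ω, P ω * Real.exp (-l * X ω)) := by
    rw [← hP.2, Finset.mul_sum, ← Finset.sum_add_distrib, ← Finset.sum_add_distrib,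
      Finset.mul_sum, ← Finset.sum_add_distrib]
    refine Finset.sum_le_sum fun ω _ => ?_
    have := mul_le_mul_of_nonneg_left (exp_neg_mul_le hβ hl (X ω)) (hP.1 ω)
    linarith
  have h5 := mul_le_mul_of_nonneg_left (add_le_add h2 h1)
    (show 0 ≤ 8 * β ^ 2 / l ^ 2 by positivity)
  have h6 : Real.log (∑ ω, P ω * Real.exp (-β * X ω)) ≤
      β * (16 * C / l ^ 2 * β - ∑ ω, P ω * X ω) := by
    have : 8 * β ^ 2 / l ^ 2 * (C + C) = β * (16 * C / l ^ 2 * β) := by ring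
    linarith
  have h7 := mul_le_mul_of_nonneg_left h6 (inv_nonneg.2 hβ.le)
  rw [inv_mul_cancel_left₀ hβ.ne'] at h7
  linarith

end Erm

/-! ### The grid of risk levels -/

theorem gridSeq_le_of_lt_succ {α δ : ℝ} (hα : α ∈ Set.Ioo (0 : ℝ) 1) (hδ : 0 < δ) {b β : ℝ}
    (hb : 0 < b) (hbm : b < -Real.log α / δ) (hβ : β < b * Real.log α / (b * δ + Real.log α))
    (hβ0 : 0 < β) : β⁻¹ * Real.log α ≤ b⁻¹ * Real.log α + δ := by
  have hl : Real.log α < 0 := Real.log_neg hα.1 hα.2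
  have hden : b * δ + Real.log α < 0 := by
    rw [lt_div_iff₀ hδ] at hbm
    linarith
  have h1 := (inv_lt_inv₀ (hβ0.trans hβ) hβ0).2 hβ
  -- The recursion adds `δ / log α` to the inverse, so the penalties of consecutive untruncated
  -- iterates differ by exactly `δ`.
  rw [inv_div] at h1
  have h2 := mul_le_mul_of_nonpos_right h1.le hl.le
  refine h2.trans (le_of_eq ?_)
  have := hl.ne
  field_simp
  ring

/-- Every `β ≥ β₀` has a grid point below it whose penalty is within `δ`. -/
theorem exists_mem_betaGrid {α β₀ δ : ℝ} (hα : α ∈ Set.Ioo (0 : ℝ) 1) (hβ₀ : 0 < β₀) (hδ : 0 < δ)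
    {β : ℝ} (hβ : β₀ ≤ β) :
    ∃ b ∈ betaGrid α β₀ δ, 0 < b ∧ b ≤ β ∧ β⁻¹ * Real.log α ≤ b⁻¹ * Real.log α + δ := by
  have hl : Real.log α < 0 := Real.log_neg hα.1 hα.2
  have hfin : (betaGrid α β₀ δ ∩ Set.Iic β).Finite :=
    (betaGrid_finite hα hβ₀ hδ).subset Set.inter_subset_left
  -- Take the largest grid point not above `β`; unless it is terminal, `β` lies below its
  -- untruncated successor.
  obtain ⟨b, ⟨⟨k, rfl⟩, hbβ⟩, hmax⟩ :=
    hfin.exists_maximal ⟨β₀, ⟨0, rfl⟩, hβ⟩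
  have hb := gridSeq_pos α β₀ δ hα.1 hα.2 hβ₀ hδ k
  have hβ0 : 0 < β := hβ₀.trans_le hβ
  refine ⟨_, ⟨k, rfl⟩, hb, hbβ, ?_⟩
  by_cases hm : gridSeq α β₀ δ k < -Real.log α / δ
  · refine gridSeq_le_of_lt_succ hα hδ hb hm ?_ hβ0
    by_contra! hle
    have hden : gridSeq α β₀ δ k * δ + Real.log α < 0 := by
      rw [lt_div_iff₀ hδ] at hm
      linarith
    have hsucc : gridSeq α β₀ δ (k + 1) =
        min (gridSeq α β₀ δ k * Real.log α / (gridSeq α β₀ δ k * δ + Real.log α))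
          (-Real.log α / δ) := by
      rw [gridSeq, if_pos hm]
    have hlt : gridSeq α β₀ δ k < gridSeq α β₀ δ (k + 1) := by
      rw [hsucc]
      refine lt_min ?_ hm
      rw [lt_div_iff_of_neg hden]
      nlinarith [mul_pos (mul_pos hb hb) hδ]
    have h1 : gridSeq α β₀ δ (k + 1) ≤ β := by
      rw [hsucc]
      exact (min_le_left _ _).trans hle
    exact absurd (hmax ⟨⟨k + 1, rfl⟩, h1⟩ hlt.le) (not_le.2 hlt)
  -- At or beyond `-log α / δ` the penalty is already at least `-δ`, while that of `β` is
  -- nonpositive.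
  · have h1 : β⁻¹ * Real.log α ≤ 0 :=
      mul_nonpos_of_nonneg_of_nonpos (inv_nonneg.2 hβ0.le) hl.le
    have h2 : (gridSeq α β₀ δ k)⁻¹ * -Real.log α ≤ δ := by
      rw [inv_mul_le_iff₀ hb]
      rwa [not_lt, div_le_iff₀ hδ] at hm
    linarith

/-! ### Exchanging the limit in time with the supremum over risk levels -/

theorem EReal.tendsto_add_coe {ι : Type*} {f : Filter ι} {u : ι → EReal} {x : EReal}
    (h : Tendsto u f (𝓝 x)) (c : ℝ) : Tendsto (fun i => u i + (c : EReal)) f (𝓝 (x + c)) :=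
  (EReal.continuousAt_add (p := (x, (c : EReal))) (Or.inr (EReal.coe_ne_bot c))
    (Or.inr (EReal.coe_ne_top c))).tendsto.comp (h.prodMk_nhds tendsto_const_nhds)

/-- Penalized suprema of functions that are antitone in the risk level converge to the penalized
supremum of the pointwise limits. -/
theorem tendsto_iSup_add_penalty {g : ℕ → ℝ → ℝ} {G : ℝ → EReal} {α C l : ℝ}
    (hα : α ∈ Set.Ioo (0 : ℝ) 1) (hl : 0 < l)
    (hg : ∀ t β β', 0 ≤ β → β ≤ β' → g t β' ≤ g t β)
    (hC : ∀ t, g t 0 ≤ C) (hC' : ∀ t, -C ≤ g t l)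
    (hG : ∀ β, 0 < β → Tendsto (fun t => (g t β : EReal)) atTop (𝓝 (G β))) :
    ∃ L : ℝ, (L : EReal) =
        ⨆ β : {β : ℝ // 0 < β}, (G β + (((β : ℝ)⁻¹ * Real.log α : ℝ) : EReal)) ∧
      Tendsto (fun t => ⨆ β : {β : ℝ // 0 < β},
        ((g t β + (β : ℝ)⁻¹ * Real.log α : ℝ) : EReal)) atTop (𝓝 (L : EReal)) := by
  have hlog : Real.log α < 0 := Real.log_neg hα.1 hα.2
  set H : EReal := ⨆ β : {β : ℝ // 0 < β}, (G β + (((β : ℝ)⁻¹ * Real.log α : ℝ) : EReal)) with hH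
  have hlim : ∀ β, 0 < β → Tendsto (fun t => ((g t β + β⁻¹ * Real.log α : ℝ) : EReal)) atTop
      (𝓝 (G β + ((β⁻¹ * Real.log α : ℝ) : EReal))) := fun β hβ => by
    simpa only [EReal.coe_add] using EReal.tendsto_add_coe (hG β hβ) (β⁻¹ * Real.log α)
  have hpen : ∀ β : ℝ, 0 < β → β⁻¹ * Real.log α ≤ 0 := fun β hβ =>
    mul_nonpos_of_nonneg_of_nonpos (inv_nonneg.2 hβ.le) hlog.le
  have hHC : H ≤ (C : EReal) := iSup_le fun β =>
    le_of_tendsto' (hlim β β.2) fun t => EReal.coe_le_coe_iff.2 (by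
      linarith [hpen β β.2, hC t, hg t 0 β le_rfl β.2.le])
  have hHl : ((-C + l⁻¹ * Real.log α : ℝ) : EReal) ≤ H :=
    le_trans (ge_of_tendsto' (hlim l hl) fun t => EReal.coe_le_coe_iff.2 (by linarith [hC' t]))
      (le_iSup (fun β : {β : ℝ // 0 < β} => G β + (((β : ℝ)⁻¹ * Real.log α : ℝ) : EReal)) ⟨l, hl⟩)
  have hHb : H ≠ ⊥ := ((EReal.bot_lt_coe _).trans_le hHl).ne'
  have hHt : H ≠ ⊤ := (hHC.trans_lt (EReal.coe_lt_top _)).ne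
  obtain ⟨L, hL⟩ : ∃ L : ℝ, (L : EReal) = H := ⟨H.toReal, EReal.coe_toReal hHt hHb⟩
  refine ⟨L, hL, tendsto_order.2 ⟨fun a ha => ?_, fun a ha => ?_⟩⟩
  · rw [hL, hH, lt_iSup_iff] at ha
    obtain ⟨β, hβ⟩ := ha
    filter_upwards [(hlim β β.2).eventually (lt_mem_nhds hβ)] with t ht
    exact ht.trans_le (le_iSup (fun β : {β : ℝ // 0 < β} =>
      ((g t β + (β : ℝ)⁻¹ * Real.log α : ℝ) : EReal)) β)
  · obtain ⟨L', hL1, hL2⟩ := EReal.lt_iff_exists_real_btwn.1 ha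
    rw [EReal.coe_lt_coe_iff] at hL1
    have hLC : L ≤ C := EReal.coe_le_coe_iff.1 (hL ▸ hHC)
    -- One `η` is spent on convergence at the grid points, the other on the grid spacing.
    set η := (L' - L) / 2 with hη
    have hη0 : 0 < η := by
      rw [hη]
      linarith
    have hden : 0 < C - L + 1 := by linarith
    -- Below this level the penalty is less than `-(C - L + 1)`, so the penalized values stay below
    -- `L - 1` uniformly in `t`.
    set β₀ := -Real.log α / (C - L + 1) with hβ₀
    have hβ₀pos : 0 < β₀ := div_pos (by linarith) hden
    have hβ₀inv : β₀⁻¹ * Real.log α = -(C - L + 1) := by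
      rw [hβ₀]
      have := hlog.ne
      field_simp
    have hev : ∀ᶠ t in atTop, ∀ b ∈ betaGrid α β₀ η, g t b + b⁻¹ * Real.log α < L + η := by
      refine (Set.Finite.eventually_all (betaGrid_finite hα hβ₀pos hη0)).2 ?_
      rintro _ ⟨k, rfl⟩
      have hb := gridSeq_pos α β₀ η hα.1 hα.2 hβ₀pos hη0 k
      have h1 := le_iSup (fun β : {β : ℝ // 0 < β} =>
        G β + (((β : ℝ)⁻¹ * Real.log α : ℝ) : EReal)) ⟨_, hb⟩
      have h2 : (L : EReal) < ((L + η : ℝ) : EReal) := EReal.coe_lt_coe_iff.2 (by linarith)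
      rw [hL] at h2
      filter_upwards [(hlim _ hb).eventually (gt_mem_nhds (h1.trans_lt h2))] with t ht
      exact EReal.coe_lt_coe_iff.1 ht
    filter_upwards [hev] with t ht
    refine lt_of_le_of_lt (iSup_le fun β => EReal.coe_le_coe_iff.2 ?_) hL2
    obtain ⟨β, hβ⟩ := β
    simp only
    rcases lt_or_ge β β₀ with h | h
    · have h1 : β⁻¹ * Real.log α ≤ β₀⁻¹ * Real.log α :=
        mul_le_mul_of_nonpos_right ((inv_le_inv₀ hβ₀pos hβ).2 h.le) hlog.le
      linarith [hC t, hg t 0 β le_rfl hβ.le]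
    · obtain ⟨b, hbm, hb0, hbβ, hpb⟩ := exists_mem_betaGrid hα hβ₀pos hη0 h
      linarith [ht b hbm, hg t b β hb0.le hbβ]

/-! ### Entropic risk and EVaR of the total reward -/

namespace FinMDP

variable {S A : Type*} [Fintype S] [Fintype A]

theorem pathProb_mem (M : FinMDP S A) (π : HistPolicy S A) (n : ℕ) :
    (fun ω : Hist S A n => M.pathProb M.init π ω) ∈ stdSimplex ℝ (Hist S A n) :=
  ⟨fun ω => M.pathProb_nonneg M.init_mem.1 π ω, M.sum_pathProb M.init_mem π n⟩

theorem g_antitone (M : FinMDP S A) (t : ℕ) (π : HistPolicy S A) {β β' : ℝ} (h0 : 0 ≤ β)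
    (h : β ≤ β') : M.g t π β' ≤ M.g t π β :=
  erm_antitone (M.pathProb_mem π (t + 1)) _ h0 h

theorem phi_one (M : FinMDP S A) (π : HistPolicy S A) (β : ℝ) (n : ℕ) :
    M.phi M.init π β n (fun _ => 1) =
      ∑ ω : Hist S A n, M.pathProb M.init π ω * Real.exp (-β * M.totalReward ω) := by
  simp [phi]

theorem phi_one_pos (M : FinMDP S A) (π : HistPolicy S A) (β : ℝ) (n : ℕ) :
    0 < M.phi M.init π β n (fun _ => 1) := by
  rw [phi_one]
  exact sum_mul_exp_pos (M.pathProb_mem π n) _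

theorem g_of_pos (M : FinMDP S A) (t : ℕ) (π : HistPolicy S A) {β : ℝ} (hβ : 0 < β) :
    M.g t π β = -β⁻¹ * Real.log (M.phi M.init π β (t + 1) (fun _ => 1)) := by
  rw [phi_one]
  exact erm_of_pos hβ _

theorem exists_g_bounds [Nonempty A] (M : FinMDP S A) (htrans : M.IsTransient) :
    ∃ l C : ℝ, 0 < l ∧ ∀ (π : HistPolicy S A) (t : ℕ), M.g t π 0 ≤ C ∧ -C ≤ M.g t π l := by
  obtain ⟨l, C, hl, hC1, h⟩ := M.exists_phi_one_le htrans M.init_mem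
  refine ⟨l, C / l, hl, fun π t => ⟨?_, ?_⟩⟩
  -- The moment at `-l` controls the mean through `l * x ≤ exp (l * x)`.
  · have h1 := h (-l) (by rw [abs_neg, abs_of_pos hl]) π (t + 1)
    rw [phi_one] at h1
    rw [le_div_iff₀ hl]
    refine le_trans ?_ h1
    unfold g
    rw [erm_zero, Finset.sum_mul]
    refine Finset.sum_le_sum fun ω _ => ?_
    rw [mul_assoc]
    refine mul_le_mul_of_nonneg_left ?_ ((M.pathProb_mem π (t + 1)).1 ω)
    have := Real.add_one_le_exp (-(-l) * M.totalReward ω)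
    linarith
  · rw [g_of_pos M t π hl, neg_mul, neg_le_neg_iff, inv_mul_eq_div]
    refine div_le_div_of_nonneg_right ?_ hl.le
    have h1 := h l (abs_of_pos hl).le π (t + 1)
    linarith [Real.log_le_sub_one_of_pos (M.phi_one_pos π l (t + 1))]

theorem exists_g_zero_le [Nonempty A] (M : FinMDP S A) (htrans : M.IsTransient) {δ : ℝ}
    (hδ : 0 < δ) :
    ∃ β₀ : ℝ, 0 < β₀ ∧ ∀ (π : HistPolicy S A) (t : ℕ), M.g t π 0 ≤ M.g t π β₀ + δ := by
  obtain ⟨l, C, hl, hC1, h⟩ := M.exists_phi_one_le htrans M.init_mem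
  have hK : 0 < 16 * C / l ^ 2 := by positivity
  -- The first term permits the estimate `erm_zero_le`; the second makes its error at most `δ`.
  refine ⟨min (l / 2) (δ / (16 * C / l ^ 2)), by positivity, fun π t => ?_⟩
  refine (erm_zero_le (M.pathProb_mem π (t + 1)) M.totalReward (l := l) (C := C) (by positivity)
    (min_le_left _ _) ?_ ?_).trans (add_le_add le_rfl ?_)
  · rw [← phi_one]
    exact h l (abs_of_pos hl).le π (t + 1)
  · rw [← phi_one]
    exact h (-l) (by rw [abs_neg, abs_of_pos hl]) π (t + 1)
  · rw [mul_comm, ← le_div_iff₀ hK]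
    exact min_le_right _ _

theorem nonempty_action (π : HistPolicy S A) : Nonempty A := by
  by_contra hA
  rw [not_nonempty_iff] at hA
  have := (π.prob_mem 0 (fun _ => none, fun i => i.elim0)).2
  simp at this

theorem exists_gStarInf_zero_le (M : FinMDP S A) (htrans : M.IsTransient) {δ : ℝ}
    (hδ : 0 < δ) : ∃ β₀ : ℝ, 0 < β₀ ∧ M.gStarInf 0 ≤ M.gStarInf β₀ + (δ : EReal) := by
  rcases isEmpty_or_nonempty A with hA | hA
  -- Without actions there are no policies, all suprema are `⊥`, and any `β₀` works.
  · have : IsEmpty (HistPolicy S A) := ⟨fun π => hA.false (nonempty_action π).some⟩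
    exact ⟨1, one_pos, by simp [gStarInf, gStar]⟩
  obtain ⟨β₀, hβ₀, h⟩ := M.exists_g_zero_le htrans hδ
  refine ⟨β₀, hβ₀, ?_⟩
  have h1 : ∀ t, M.gStar t 0 + ((-δ : ℝ) : EReal) ≤ M.gStar t β₀ := fun t => by
    rw [EReal.coe_neg, ← sub_eq_add_neg, EReal.sub_le_iff_le_add (Or.inl (EReal.coe_ne_bot _))
      (Or.inl (EReal.coe_ne_top _))]
    refine iSup_le fun π => ?_
    calc (M.g t π 0 : EReal) ≤ ((M.g t π β₀ + δ : ℝ) : EReal) := EReal.coe_le_coe_iff.2 (h π t)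
      _ = (M.g t π β₀ : EReal) + δ := EReal.coe_add _ _
      _ ≤ _ := add_le_add (le_iSup (fun π => (M.g t π β₀ : EReal)) π) le_rfl
  rw [← EReal.sub_le_iff_le_add (Or.inl (EReal.coe_ne_bot _)) (Or.inl (EReal.coe_ne_top _)),
    sub_eq_add_neg, ← EReal.coe_neg]
  calc _ = M.gStarInf 0 + liminf (fun _ : ℕ => ((-δ : ℝ) : EReal)) atTop := by
        rw [liminf_const]
    _ ≤ liminf ((fun t => M.gStar t 0) + fun _ => ((-δ : ℝ) : EReal)) atTop := EReal.le_liminf_add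
    _ ≤ _ := liminf_le_liminf (Eventually.of_forall h1)

theorem g_tendsto_of_phi_tendsto [Nonempty A] (M : FinMDP S A) (htrans : M.IsTransient)
    (π : HistPolicy S A) {β : ℝ} (hβ : 0 < β) {D : ℝ}
    (h : Tendsto (fun t => M.phi M.init π β t (fun _ => 1)) atTop (𝓝 D)) :
    0 < D ∧ Tendsto (fun t => M.g t π β) atTop (𝓝 (-β⁻¹ * Real.log D)) := by
  obtain ⟨l, C, -, hC⟩ := M.exists_g_bounds htrans
  have h1 := h.comp (tendsto_add_atTop_nat 1)
  have hD : 0 < D := by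
    -- The ERM is at most the mean, hence at most `C`, which keeps the moment above `exp (-(β *
    -- C))`.
    refine (Real.exp_pos (-(β * C))).trans_le (ge_of_tendsto' h1 fun t => ?_)
    have h2 := (M.g_antitone t π le_rfl hβ.le).trans (hC π t).1
    rw [g_of_pos M t π hβ, neg_mul, neg_le, inv_mul_eq_div, le_div_iff₀ hβ,
      Real.le_log_iff_exp_le (M.phi_one_pos π β (t + 1))] at h2
    rwa [neg_mul, mul_comm] at h2
  refine ⟨hD, ?_⟩
  refine (((Real.continuousAt_log hD.ne').tendsto.comp h1).const_mul (-β⁻¹)).congr fun t => ?_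
  exact (M.g_of_pos t π hβ).symm

/-- The entropic risk of the total reward converges in the extended reals for every policy. -/
theorem g_tendsto_gInf [Nonempty A] (M : FinMDP S A) (htrans : M.IsTransient)
    (π : HistPolicy S A) {β : ℝ} (hβ : 0 < β) :
    Tendsto (fun t => (M.g t π β : EReal)) atTop (𝓝 (M.gInf π β)) := by
  have key : ∃ x, Tendsto (fun t => (M.g t π β : EReal)) atTop (𝓝 x) := by
    rcases M.phi_one_tendsto htrans β M.init_mem.1 π with ⟨D, hD⟩ | h
    · exact ⟨_, (continuous_coe_real_ereal.tendsto _).comp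
        (M.g_tendsto_of_phi_tendsto htrans π hβ hD).2⟩
    · refine ⟨⊥, EReal.tendsto_coe_nhds_bot_iff.2 ?_⟩
      have h1 := Real.tendsto_log_atTop.comp (h.comp (tendsto_add_atTop_nat 1))
      refine (h1.const_mul_atTop_of_neg (neg_lt_zero.2 (inv_pos.2 hβ))).congr fun t => ?_
      exact (M.g_of_pos t π hβ).symm
  obtain ⟨x, hx⟩ := key
  rwa [gInf, hx.liminf_eq]

/-- Stationary deterministic policies attain the optimal entropic risk in the limit. -/
theorem exists_stationary_le_gInf [Nonempty A] (M : FinMDP S A) (htrans : M.IsTransient)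
    (hinit : ∀ s : S, 0 < M.init (some s)) {β : ℝ} (hβ : 0 < β) {c : ℝ}
    (hc : (c : EReal) < M.gStarInf β) :
    ∃ d : Option S → A, (c : EReal) ≤ M.gInf (HistPolicy.stationary d) β := by
  have h1 : ∀ᶠ t in atTop, (c : EReal) < M.gStar t β := eventually_lt_of_lt_liminf hc
  have h2 : ∀ᶠ t in atTop, ∃ π, M.phi M.init π β (t + 1) (fun _ => 1) ≤ Real.exp (-(β * c)) := by
    filter_upwards [h1] with t ht
    obtain ⟨π, hπ⟩ := lt_iSup_iff.1 ht
    refine ⟨π, ?_⟩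
    have h3 := (EReal.coe_lt_coe_iff.1 hπ).le
    rw [g_of_pos M t π hβ, neg_mul, le_neg, inv_mul_eq_div, div_le_iff₀ hβ,
      Real.log_le_iff_le_exp (M.phi_one_pos π β (t + 1))] at h3
    convert h3 using 2
    ring
  obtain ⟨d, D, hDC, hD⟩ := M.exists_stationary_tendsto_le htrans hinit β _
    ((tendsto_add_atTop_nat 1).frequently h2.frequently)
  obtain ⟨hD0, hg⟩ := M.g_tendsto_of_phi_tendsto htrans _ hβ hD
  refine ⟨d, ?_⟩
  have h4 : Tendsto (fun t => (M.g t (HistPolicy.stationary d) β : EReal)) atTop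
      (𝓝 ((-β⁻¹ * Real.log D : ℝ) : EReal)) := (continuous_coe_real_ereal.tendsto _).comp hg
  rw [gInf, h4.liminf_eq, EReal.coe_le_coe_iff, neg_mul, le_neg, inv_mul_eq_div, div_le_iff₀ hβ,
    Real.log_le_iff_le_exp hD0]
  convert hDC using 2
  ring

/-- The comparison is made through each real `c` below `gStarInf`, which avoids separate treatment
of infinite values. -/
theorem gStarInf_add_le [Nonempty A] (M : FinMDP S A) (htrans : M.IsTransient)
    (hinit : ∀ s : S, 0 < M.init (some s)) {β : ℝ} (hβ : 0 < β) {p : ℝ} {H : EReal}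
    (h : ∀ d : Option S → A, M.gInf (HistPolicy.stationary d) β + (p : EReal) ≤ H) :
    M.gStarInf β + (p : EReal) ≤ H := by
  rw [← EReal.le_sub_iff_add_le (Or.inl (EReal.coe_ne_bot _)) (Or.inl (EReal.coe_ne_top _))]
  refine EReal.ge_of_forall_gt_iff_ge.1 fun c hc => ?_
  obtain ⟨d, hd⟩ := M.exists_stationary_le_gInf htrans hinit hβ hc
  refine hd.trans ?_
  rw [EReal.le_sub_iff_add_le (Or.inl (EReal.coe_ne_bot _)) (Or.inl (EReal.coe_ne_top _))]
  exact h d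

theorem gInf_le_gStarInf (M : FinMDP S A) (π : HistPolicy S A) (β : ℝ) :
    M.gInf π β ≤ M.gStarInf β :=
  liminf_le_liminf (Eventually.of_forall fun t => le_iSup (fun π => (M.g t π β : EReal)) π)

theorem gInf_antitone (M : FinMDP S A) (π : HistPolicy S A) {β β' : ℝ} (h0 : 0 ≤ β)
    (h : β ≤ β') : M.gInf π β' ≤ M.gInf π β :=
  liminf_le_liminf (Eventually.of_forall fun t =>
    EReal.coe_le_coe_iff.2 (M.g_antitone t π h0 h))

/-- The EVaR of the total reward converges, and its limit is the supremum of `h_∞(π, ·)`. -/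
theorem exists_evarReturn_tendsto [Nonempty A] (M : FinMDP S A) (htrans : M.IsTransient)
    {α : ℝ} (hα : α ∈ Set.Ioo (0 : ℝ) 1) (π : HistPolicy S A) :
    ∃ L : ℝ, (L : EReal) = ⨆ β : {β : ℝ // 0 < β}, M.hInf α π β ∧
      Tendsto (fun t => M.evarReturn α π t) atTop (𝓝 (L : EReal)) := by
  obtain ⟨l, C, hl, hC⟩ := M.exists_g_bounds htrans
  exact tendsto_iSup_add_penalty (g := fun t β => M.g t π β) hα hl
    (fun t β β' h0 h => M.g_antitone t π h0 h) (fun t => (hC π t).1) (fun t => (hC π t).2)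
    (fun β hβ => M.g_tendsto_gInf htrans π hβ)

/-- The grid optimum over stationary deterministic policies bounds `h_∞` up to `δ`. -/
theorem hInf_le_of_grid [Nonempty A] (M : FinMDP S A) (htrans : M.IsTransient)
    (hinit : ∀ s : S, 0 < M.init (some s)) {α : ℝ} (hα : α ∈ Set.Ioo (0 : ℝ) 1) {δ : ℝ}
    (hδ : 0 < δ) {β₀ : ℝ} (hβ₀ : 0 < β₀) (h1 : M.gStarInf 0 ≤ M.gStarInf β₀ + (δ : EReal))
    {H : EReal} (hH : ∀ d : Option S → A, ∀ β ∈ betaGrid α β₀ δ,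
      M.hInf α (HistPolicy.stationary d) β ≤ H) (π : HistPolicy S A) {β : ℝ} (hβ : 0 < β) :
    M.hInf α π β ≤ H + (δ : EReal) := by
  have hlog : Real.log α < 0 := Real.log_neg hα.1 hα.2
  have hgrid : ∀ b ∈ betaGrid α β₀ δ, 0 < b →
      M.gStarInf b + ((b⁻¹ * Real.log α : ℝ) : EReal) ≤ H := fun b hb hb0 =>
    M.gStarInf_add_le htrans hinit hb0 fun d => hH d b hb
  rcases lt_or_ge β β₀ with h | h
  -- Below `β₀`, pass to risk level zero and return to `β₀` by the assumed inequality (1), at cost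
  -- `δ`; the penalty only improves.
  · have hp : β⁻¹ * Real.log α ≤ β₀⁻¹ * Real.log α :=
      mul_le_mul_of_nonpos_right ((inv_le_inv₀ hβ₀ hβ).2 h.le) hlog.le
    calc M.hInf α π β ≤ (M.gStarInf β₀ + (δ : EReal)) + ((β₀⁻¹ * Real.log α : ℝ) : EReal) :=
          add_le_add (((M.gInf_antitone π le_rfl hβ.le).trans (M.gInf_le_gStarInf π 0)).trans h1)
            (EReal.coe_le_coe_iff.2 hp)
      _ = (M.gStarInf β₀ + ((β₀⁻¹ * Real.log α : ℝ) : EReal)) + (δ : EReal) := add_right_comm _ _ _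
      _ ≤ _ := add_le_add (hgrid β₀ ⟨0, rfl⟩ hβ₀) le_rfl
  · obtain ⟨b, hb, hb0, hbβ, hp⟩ := exists_mem_betaGrid hα hβ₀ hδ h
    calc M.hInf α π β ≤ M.gStarInf b + ((b⁻¹ * Real.log α + δ : ℝ) : EReal) :=
          add_le_add ((M.gInf_antitone π hb0.le hbβ).trans (M.gInf_le_gStarInf π b))
            (EReal.coe_le_coe_iff.2 hp)
      _ = (M.gStarInf b + ((b⁻¹ * Real.log α : ℝ) : EReal)) + (δ : EReal) := by
          rw [EReal.coe_add, add_assoc]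
      _ ≤ _ := add_le_add (hgrid b hb hb0) le_rfl

end FinMDP

end

theorem mainTheorem3 {S A : Type*} [Fintype S] [Fintype A] (M : FinMDP S A)
    (hinit : ∀ s : S, 0 < M.init (some s)) (htrans : M.IsTransient)
    (α : ℝ) (hα : α ∈ Set.Ioo (0 : ℝ) 1) (δ : ℝ) (hδ : 0 < δ) :
    (∃ β₀ : ℝ, 0 < β₀ ∧ M.gStarInf 0 ≤ M.gStarInf β₀ + (δ : EReal)) ∧
    (∀ π : HistPolicy S A, ∃ L : ℝ,
      Tendsto (fun t => M.evarReturn α π t) atTop (𝓝 (L : EReal))) ∧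
    ∀ β₀ : ℝ, 0 < β₀ → M.gStarInf 0 ≤ M.gStarInf β₀ + (δ : EReal) →
      ∀ (d' : Option S → A) (β' : ℝ), β' ∈ betaGrid α β₀ δ →
        (∀ d : Option S → A, ∀ β ∈ betaGrid α β₀ δ,
          M.hInf α (HistPolicy.stationary d) β ≤ M.hInf α (HistPolicy.stationary d') β') →
        ∃ L : ℝ,
          Tendsto (fun t => M.evarReturn α (HistPolicy.stationary d') t) atTop
            (𝓝 (L : EReal)) ∧
          M.optEvar α - (δ : EReal) ≤ (L : EReal) := by
  refine ⟨M.exists_gStarInf_zero_le htrans hδ, fun π => ?_, fun β₀ hβ₀ h1 d' β' hβ' hmax => ?_⟩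
  · have := FinMDP.nonempty_action π
    exact (M.exists_evarReturn_tendsto htrans hα π).imp fun _ h => h.2
  · have : Nonempty A := ⟨d' none⟩
    obtain ⟨L, hL, hlim⟩ := M.exists_evarReturn_tendsto htrans hα (HistPolicy.stationary d')
    refine ⟨L, hlim, ?_⟩
    have hHL : M.hInf α (HistPolicy.stationary d') β' ≤ (L : EReal) := by
      obtain ⟨k, rfl⟩ := hβ'
      rw [hL]
      exact le_iSup (fun β : {β : ℝ // 0 < β} => M.hInf α (HistPolicy.stationary d') β)
        ⟨_, gridSeq_pos α β₀ δ hα.1 hα.2 hβ₀ hδ k⟩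
    rw [EReal.sub_le_iff_le_add (Or.inl (EReal.coe_ne_bot _)) (Or.inl (EReal.coe_ne_top _))]
    refine iSup_le fun π => ?_
    obtain ⟨L', hL', hlim'⟩ := M.exists_evarReturn_tendsto htrans hα π
    rw [hlim'.liminf_eq, hL']
    exact iSup_le fun β => (M.hInf_le_of_grid htrans hinit hα hδ hβ₀ h1 hmax π β.2).trans
      (add_le_add hHL le_rfl)
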